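/- Let $A$ be a simple Artinian ring and let $R$ be a Dubrovin valuation ring of $A$ with $R\neq A$; that is, $R$ is a proper subring of $A$ having a two-sided ideal $M$ such that $R/M$ is simple Artinian and such that for every $q\in A\setminus R$ there are $r,r'\in R$ with $rq\in R\setminus M$ and $qr'\in R\setminus M$. Let $P=J(R)$ be the Jacobson radical of $R$. A ring is called Goldie if its regular elements satisfy the left and right Ore conditions and the resulting ring of fractions is semisimple Artinian; a prime ideal $Q$ of $R$ is called a Goldie prime if $R/Q$ is a Goldie ring; and the rank of $R$ is the maximal length $n$ of a chain $Q_0\subsetneq Q_1\subsetneq\dots\subsetneq Q_n$ of Goldie prime ideals of $R$. Then the following are equivalent: (1) $R$ is (left and right) Noetherian; (2) $R$ has rank $1$ and $P\neq P^2$; (3) $R$ has rank $1$ and $\bigcap_{n\geq 1}P^n=0$. -/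

import Mathlib

open scoped nonZeroDivisors

/-- A ring is left and right Noetherian. -/
def IsTwoSidedNoetherianRing (R : Type*) [Ring R] : Prop :=
  IsNoetherianRing R ∧ IsNoetherianRing Rᵐᵒᵖ

/-- The regular elements of `R` satisfy the left Ore condition, and the localization of `R` at
them is a semisimple Artinian ring. (`R⁰` consists of the elements that are neither left nor right
zero divisors, and `OreLocalization` is the ring of left fractions.) -/
def IsLeftGoldieRing (R : Type*) [Ring R] : Prop :=
  ∃ _ : OreLocalization.OreSet R⁰, IsSemisimpleRing (OreLocalization R⁰ R)

/-- A (left and right) Goldie ring. -/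
def IsGoldieRing (R : Type*) [Ring R] : Prop :=
  IsLeftGoldieRing R ∧ IsLeftGoldieRing Rᵐᵒᵖ

/-- A Goldie prime ideal of a (noncommutative) ring: a proper two-sided ideal `Q` such that
`a R b ⊆ Q` implies `a ∈ Q` or `b ∈ Q`, and such that `R ⧸ Q` is a Goldie ring. -/
structure IsGoldiePrime {R : Type*} [Ring R] (Q : Ideal R) : Prop where
  isTwoSided : Q.IsTwoSided
  ne_top : Q ≠ ⊤
  mem_or_mem : ∀ a b : R, (∀ r : R, a * r * b ∈ Q) → a ∈ Q ∨ b ∈ Q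
  isGoldieRing : IsGoldieRing (R ⧸ Q)

/-- The supremum of the lengths `n` of the chains `Q₀ ⊂ Q₁ ⊂ ⋯ ⊂ Qₙ` of Goldie prime ideals. -/
noncomputable def goldieRank (R : Type*) [Ring R] : WithBot ℕ∞ :=
  Order.krullDim {Q : Ideal R // IsGoldiePrime Q}

/-- A subring `R` of `A` (in practice a simple Artinian ring) is a Dubrovin valuation ring of `A`
if it has a two-sided ideal `M` such that `R ⧸ M` is simple Artinian and such that for every
`q ∈ A` outside `R` there are `r, r' ∈ R` with `r q` and `q r'` in `R` but not in `M`. -/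
def IsDubrovinValuationRing {A : Type*} [Ring A] (R : Subring A) : Prop :=
  ∃ (M : Ideal R) (_ : M.IsTwoSided),
    IsSimpleRing (R ⧸ M) ∧ IsArtinianRing (R ⧸ M) ∧
    ∀ q : A, q ∉ R →
      (∃ r x : R, (r : A) * q = x ∧ x ∉ M) ∧ (∃ r' x : R, q * (r' : A) = x ∧ x ∉ M)

/-! Write I for the intersection of the powers of M. The Dubrovin condition makes M the Jacobson
radical (`IsDubrovinPair.eq_jacobson`) and makes finitely generated R-submodules of A cyclic
(`exists_eq_span_singleton`). Hence A consists of fractions of R, and nonzero two-sided ideals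
contain units of A.

The pivot is M ≠ M². It gives M = Rp = pR with p a unit of A (`exists_isNormalGenerator`), so that
M^n = Rp^n, and then I decides everything. Under (1), Nakayama yields M ≠ M² and, as I = pI, also I
= 0; a prime omitting p lies in I, so the Goldie primes are 0 and M. Under (3), M = M² would give M
= I = 0, impossible as R ≠ A. Under (2), a nonzero I would be a Goldie prime strictly between 0 and
M; once I = 0, every left ideal is a summand of one containing a power of p, and those are finitely
generated.

The hard step is `exists_pow_mem_span_of_essential`: if s is a unit of A and Rs + I is essential
over I, then Rs contains a power of p. For I ≠ 0 it makes R[p⁻¹]/I semisimple; for I = 0 it gives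
Noetherianity. Right-handed statements follow by passing to the opposite subring. -/

section Generalities

variable {B : Type*} [Ring B]

theorem Ideal.eq_top_of_isSimpleRing [IsSimpleRing B] {I : Ideal B} (hI : I.IsTwoSided)
    (h : I ≠ ⊥) : I = ⊤ :=
  ((isSimpleRing_iff_isTwoSided_imp.mp ‹IsSimpleRing B›).2 I hI).resolve_left h

theorem IsArtinianRing.isUnit_of_forall_mul_eq_zero [IsArtinianRing B] {a : B}
    (h : ∀ x, x * a = 0 → x = 0) : IsUnit a := by
  obtain ⟨y, hy⟩ := IsArtinian.surjective_of_injective_endomorphism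
    (LinearMap.toSpanSingleton B B a) ((injective_iff_map_eq_zero _).2 fun x hx => h x hx) 1
  exact IsUnit.of_mul_eq_one_right y hy

end Generalities

/-! ### Dubrovin pairs: symmetry, units of A, the Jacobson radical -/

section Dubrovin

variable {A : Type*} [Ring A]

/-- The condition which, for a maximal two-sided ideal `M` of `R` with simple Artinian quotient,
makes the subring `R` of `A` a Dubrovin valuation ring. -/
structure IsDubrovinPair (R : Subring A) (M : Ideal R) : Prop where
  left : ∀ q : A, q ∉ R → ∃ r x : R, (r : A) * q = x ∧ x ∉ M
  right : ∀ q : A, q ∉ R → ∃ r x : R, q * (r : A) = x ∧ x ∉ M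

/-- The right-left transpose of a two-sided ideal. -/
def Subring.opIdeal {R : Subring A} (M : Ideal R) [M.IsTwoSided] : Ideal R.op where
  carrier := {x | (⟨x.1.unop, x.2⟩ : R) ∈ M}
  add_mem' := fun ha hb => M.add_mem ha hb
  zero_mem' := M.zero_mem
  smul_mem' := fun c _ hx => Ideal.IsTwoSided.mul_mem_of_left (I := M) (⟨c.1.unop, c.2⟩ : R) hx

theorem Subring.mem_opIdeal {R : Subring A} {M : Ideal R} [M.IsTwoSided] {x : R.op} :
    x ∈ Subring.opIdeal M ↔ (⟨x.1.unop, x.2⟩ : R) ∈ M := Iff.rfl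

instance {R : Subring A} (M : Ideal R) [M.IsTwoSided] : (Subring.opIdeal M).IsTwoSided where
  mul_mem_of_left := fun {_} b ha => M.mul_mem_left (⟨b.1.unop, b.2⟩ : R) ha

/-- The quotient by the transposed ideal is the opposite of the quotient. -/
noncomputable def Subring.quotientOpIdealEquiv {R : Subring A} (M : Ideal R) [M.IsTwoSided] :
    R.op ⧸ Subring.opIdeal M ≃+* (R ⧸ M)ᵐᵒᵖ :=
  let f : R.op →+* (R ⧸ M)ᵐᵒᵖ :=
    (RingHom.op (Ideal.Quotient.mk M)).comp (R.mopRingEquivOp.symm : R.op →+* Rᵐᵒᵖ)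
  have hf : Function.Surjective f := fun y => by
    obtain ⟨x, hx⟩ := Ideal.Quotient.mk_surjective y.unop
    exact ⟨R.mopRingEquivOp (.op x), by simp [f, hx]⟩
  have hk : Subring.opIdeal M = RingHom.ker f := by
    ext x
    rw [Subring.mem_opIdeal, RingHom.mem_ker, ← Ideal.Quotient.eq_zero_iff_mem]
    exact MulOpposite.op_eq_zero_iff _ |>.symm
  (Ideal.quotEquivOfEq hk).trans (RingHom.quotientKerEquivOfSurjective hf)

instance {R : Subring A} (M : Ideal R) [M.IsTwoSided] [IsSimpleRing (R ⧸ M)] :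
    IsSimpleRing (R.op ⧸ Subring.opIdeal M) :=
  have := (Subring.quotientOpIdealEquiv M).toEquiv.nontrivial
  .of_surjective (Subring.quotientOpIdealEquiv M).symm.toRingHom inferInstance
    (Subring.quotientOpIdealEquiv M).symm.surjective

instance {R : Subring A} (M : Ideal R) [M.IsTwoSided] [IsSimpleRing (R ⧸ M)]
    [IsArtinianRing (R ⧸ M)] : IsArtinianRing (R.op ⧸ Subring.opIdeal M) :=
  (Subring.quotientOpIdealEquiv M).symm.isArtinianRing

theorem IsDubrovinPair.op {R : Subring A} {M : Ideal R} [M.IsTwoSided] (h : IsDubrovinPair R M) :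
    IsDubrovinPair R.op (Subring.opIdeal M) where
  left q hq := by
    obtain ⟨r, x, h1, h2⟩ := h.right q.unop hq
    exact ⟨⟨.op r, r.2⟩, ⟨.op x, x.2⟩, congrArg MulOpposite.op h1, h2⟩
  right q hq := by
    obtain ⟨r, x, h1, h2⟩ := h.left q.unop hq
    exact ⟨⟨.op r, r.2⟩, ⟨.op x, x.2⟩, congrArg MulOpposite.op h1, h2⟩

variable {R : Subring A} {M : Ideal R} [M.IsTwoSided] [IsSimpleRing (R ⧸ M)]

theorem Ideal.ne_top_of_isSimpleRing_quotient {R : Type*} [Ring R] (M : Ideal R) [M.IsTwoSided]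
    [IsSimpleRing (R ⧸ M)] : M ≠ ⊤ :=
  Ideal.Quotient.nontrivial_iff.1 inferInstance

/-- The largest left ideal I of A inside M is stable under right multiplication by R, and I = Ae
with e idempotent. The Dubrovin condition gives eA(1 - e) = 0, so I is two-sided; simplicity leaves
I = 0, since I = A would put 1 in M. -/
theorem IsDubrovinPair.eq_bot_of_forall_mem [IsSimpleRing A] [IsArtinianRing A]
    (h : IsDubrovinPair R M) (L : Ideal A) (hL : ∀ x ∈ L, ∃ m ∈ M, (m : A) = x) : L = ⊥ := by
  let I : Ideal A :=
    { carrier := {x | ∀ a : A, ∃ m ∈ M, (m : A) = a * x}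
      add_mem' := fun {x y} hx hy a => by
        obtain ⟨m, hm, e⟩ := hx a
        obtain ⟨m', hm', e'⟩ := hy a
        exact ⟨m + m', M.add_mem hm hm', by simp [e, e', mul_add]⟩
      zero_mem' := fun a => ⟨0, M.zero_mem, by simp⟩
      smul_mem' := fun c x hx a => by
        obtain ⟨m, hm, e⟩ := hx (a * c)
        exact ⟨m, hm, by simp [e, mul_assoc]⟩ }
  have hIR : ∀ x ∈ I, ∀ r : R, x * r ∈ I := fun x hx r a => by
    obtain ⟨m, hm, e⟩ := hx a
    exact ⟨m * r, Ideal.IsTwoSided.mul_mem_of_left r hm, by simp [e, mul_assoc]⟩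
  have hIM : ∀ x ∈ I, ∃ m ∈ M, (m : A) = x := fun x hx => by simpa using hx 1
  have hLI : L ≤ I := fun x hx a => hL _ (L.mul_mem_left a hx)
  have : IsSemisimpleRing A := IsSimpleRing.isSemisimpleRing_iff_isArtinianRing.2 inferInstance
  obtain ⟨e, he, hIe⟩ := IsSemisimpleRing.ideal_eq_span_idempotent I
  have heI : e ∈ I := hIe ▸ Ideal.mem_span_singleton_self e
  have hmul : ∀ x ∈ I, x * e = x := fun x hx => by
    rw [hIe, Ideal.mem_span_singleton'] at hx
    obtain ⟨a, rfl⟩ := hx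
    rw [mul_assoc, he.eq]
  -- For q = ea(1 - e), eq = q and qe = 0. If q ∈ R, then q = eq ∈ I, so q = qe = 0. Otherwise some
  -- qr ∈ R lies outside M, yet qr = e(qr) ∈ I, which is inside M.
  have hz : ∀ a : A, e * a * (1 - e) = 0 := fun a => by
    have heq : e * (e * a * (1 - e)) = e * a * (1 - e) := by
      rw [← mul_assoc, ← mul_assoc, he.eq]
    by_cases hq : e * a * (1 - e) ∈ R
    · have := hmul _ (hIR e heI ⟨_, hq⟩)
      rw [heq, mul_assoc, sub_mul, one_mul, he.eq, sub_self, mul_zero] at this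
      exact this.symm
    · obtain ⟨r, x, hx, hxM⟩ := h.right _ hq
      refine absurd ?_ hxM
      obtain ⟨m, hm, e'⟩ := hIM _ (hIR e heI x)
      rw [← hx, ← mul_assoc, heq, hx] at e'
      rwa [Subtype.coe_injective e'] at hm
  have htwo : I.IsTwoSided := ⟨fun {x} b hx => by
    have h1 := hz b
    rw [mul_sub, mul_one, sub_eq_zero] at h1
    rw [← hmul x hx, mul_assoc, h1, ← mul_assoc]
    exact I.mul_mem_left _ heI⟩
  by_contra hne
  have hI1 := Ideal.eq_top_of_isSimpleRing htwo fun hI => hne (le_bot_iff.1 (hI ▸ hLI))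
  obtain ⟨m, hm, e'⟩ := hIM 1 (hI1 ▸ Submodule.mem_top)
  exact M.ne_top_of_isSimpleRing_quotient
    ((Ideal.eq_top_iff_one M).2 (by rwa [Subtype.coe_injective (a₂ := (1 : R)) e'] at hm))

/-- The left annihilator of a in A lies in M: an annihilating y outside R would have a multiple in R
outside M that still annihilates a. So it vanishes. -/
theorem IsDubrovinPair.isUnit_of_forall_mul_eq_zero [IsSimpleRing A] [IsArtinianRing A]
    (h : IsDubrovinPair R M) {a : A} (ha : ∀ x : R, x * a = 0 → x ∈ M) : IsUnit a := by
  refine IsArtinianRing.isUnit_of_forall_mul_eq_zero fun x hx => ?_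
  have := h.eq_bot_of_forall_mem (LinearMap.ker (LinearMap.toSpanSingleton A A a)) fun y hy => by
    replace hy : y * a = 0 := hy
    by_cases hyR : y ∈ R
    · exact ⟨⟨y, hyR⟩, ha _ hy, rfl⟩
    · obtain ⟨r, x, hx, hxM⟩ := h.left y hyR
      exact absurd (ha x (by rw [← hx, mul_assoc, hy, mul_zero])) hxM
  exact (Submodule.eq_bot_iff _).1 this x hx

/-- The inverse u of 1 - m in A equals 1 + mu, and mu stays in R: if x = r(mu) were in R outside M,
then x = rm + xm would lie in M. -/
theorem IsDubrovinPair.exists_mul_one_sub [IsSimpleRing A] [IsArtinianRing A]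
    (h : IsDubrovinPair R M) {m : R} (hm : m ∈ M) : ∃ u : R, u * (1 - m) = 1 := by
  have hunit : IsUnit (1 - m : A) := h.isUnit_of_forall_mul_eq_zero fun x hx => by
    rw [mul_sub, mul_one, sub_eq_zero] at hx
    have hx2 : x = x * m := Subtype.coe_injective (by simpa using hx)
    rw [hx2]
    exact M.mul_mem_left _ hm
  obtain ⟨⟨a, u, hau, hua⟩, rfl : a = _⟩ := hunit
  have hmu : (m : A) * u ∈ R := by
    by_contra hq
    obtain ⟨r, x, hx, hxM⟩ := h.left _ hq
    refine hxM ?_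
    have : x = r * m + x * m := Subtype.coe_injective <| by
      have h1 : (x : A) * (1 - m) = r * m := by rw [← hx, mul_assoc, mul_assoc, hua, mul_one]
      push_cast
      rw [← h1]; noncomm_ring
    rw [this]
    exact M.add_mem (M.mul_mem_left _ hm) (M.mul_mem_left _ hm)
  have hu : u ∈ R := by
    have : u = 1 + m * u := by
      rw [sub_mul, one_mul, sub_eq_iff_eq_add] at hau
      exact hau
    rw [this]
    exact R.add_mem R.one_mem hmu
  exact ⟨⟨u, hu⟩, Subtype.coe_injective hua⟩

theorem IsDubrovinPair.eq_jacobson [IsSimpleRing A] [IsArtinianRing A] [IsArtinianRing (R ⧸ M)]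
    (h : IsDubrovinPair R M) : M = Ring.jacobson R := by
  refine le_antisymm (fun m hm => ?_) (Ring.jacobson_le_of_eq_bot ?_)
  · rw [← Ideal.jacobson_bot, Ideal.mem_jacobson_iff]
    intro y
    obtain ⟨z, hz⟩ := h.exists_mul_one_sub (M.neg_mem (M.mul_mem_left y hm))
    refine ⟨z, ?_⟩
    rw [Ideal.mem_bot, ← hz]
    noncomm_ring
  · have : IsSemisimpleRing (R ⧸ M) := IsSimpleRing.isSemisimpleRing_iff_isArtinianRing.2 ‹_›
    exact IsSemisimpleRing.jacobson_eq_bot _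

theorem Ideal.eq_top_of_not_le {R : Type*} [Ring R] {M : Ideal R} [M.IsTwoSided]
    [IsSimpleRing (R ⧸ M)] {I : Ideal R} [hI : I.IsTwoSided] (h : ¬ I ≤ M) : I ⊔ M = ⊤ := by
  have h2 : (I.map (Ideal.Quotient.mk M)).IsTwoSided := ⟨fun {a} b ha => by
    rw [Ideal.mem_map_iff_of_surjective _ Ideal.Quotient.mk_surjective] at ha ⊢
    obtain ⟨x, hx, rfl⟩ := ha
    obtain ⟨y, rfl⟩ := Ideal.Quotient.mk_surjective b
    exact ⟨x * y, hI.mul_mem_of_left y hx, map_mul _ _ _⟩⟩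
  have h3 := Ideal.eq_top_of_isSimpleRing h2 fun h0 => h fun x hx =>
    Ideal.Quotient.eq_zero_iff_mem.1 ((Ideal.mem_bot).1 (h0 ▸ Ideal.mem_map_of_mem _ hx))
  rw [Ideal.eq_top_iff_one, Ideal.mem_map_iff_of_surjective _ Ideal.Quotient.mk_surjective] at h3
  obtain ⟨x, hx, hx1⟩ := h3
  rw [← map_one (Ideal.Quotient.mk M), Ideal.Quotient.eq] at hx1
  rw [Ideal.eq_top_iff_one, show (1 : R) = x - (x - 1) by abel]
  exact Submodule.sub_mem_sup hx hx1

theorem IsDubrovinPair.le_of_ne_top [IsSimpleRing A] [IsArtinianRing A]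
    (h : IsDubrovinPair R M) {I : Ideal R} [I.IsTwoSided] (hI : I ≠ ⊤) : I ≤ M := by
  by_contra hle
  have := Ideal.eq_top_of_not_le hle
  rw [Ideal.eq_top_iff_one, Submodule.mem_sup] at this
  obtain ⟨x, hx, m, hm, e⟩ := this
  obtain ⟨u, hu⟩ := h.exists_mul_one_sub hm
  refine hI ((Ideal.eq_top_iff_one I).2 ?_)
  rw [← hu, ← e, add_sub_cancel_right]
  exact I.mul_mem_left _ hx

end Dubrovin

/-! ### Two-generated modules over a simple Artinian ring -/

section Semisimple

variable {S : Type*} [Ring S] [IsSimpleRing S] [IsArtinianRing S]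

/-- A module generated by two elements over a simple Artinian ring is either cyclic or the direct
sum of a free module of rank one and a nonzero cyclic module. -/
theorem IsSimpleRing.span_singleton_eq_top_or_of_span_pair {V : Type*} [AddCommGroup V]
    [Module S V] {v w : V} (hvw : Submodule.span S {v, w} = ⊤) :
    (∃ u : V, Submodule.span S {u} = ⊤) ∨ ∃ a b : V, b ≠ 0 ∧ Submodule.span S {a, b} = ⊤ ∧
      ∀ x y : S, x • a + y • b = 0 → x = 0 ∧ y • b = 0 := by
  obtain ⟨hss, hiso, -⟩ := isSimpleRing_isArtinianRing_iff.1 ⟨‹IsSimpleRing S›, ‹_›⟩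
  have hVfin : Module.Finite S V := ⟨hvw ▸ Submodule.fg_span (Set.toFinite _)⟩
  obtain ⟨S₀, hS₀⟩ := IsSemisimpleModule.exists_simple_submodule S (V × S)
  have hprod : IsIsotypicOfType S (V × S) S₀ := IsIsotypic.of_self (V × S) hiso S₀
  obtain ⟨t, ⟨eV⟩⟩ := (hprod.of_injective (LinearMap.inl S V S)
    LinearMap.inl_injective).linearEquiv_fun
  obtain ⟨k, ⟨eS⟩⟩ := (hprod.of_injective (LinearMap.inr S V S)
    LinearMap.inr_injective).linearEquiv_fun
  have key : ∀ j ≤ k, ∃ g : S →ₗ[S] (Fin j → S₀), Function.Surjective g := fun j hj =>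
    ⟨(LinearMap.funLeft S S₀ (Fin.castLE hj)).comp eS.toLinearMap,
      (LinearMap.funLeft_surjective_of_injective S S₀ _ (Fin.castLE_injective hj)).comp
        eS.surjective⟩
  have span_one : ∀ x : S, x = x • 1 := fun x => by simp
  -- Here V ≅ S₀^t and S ≅ S₀^k. If t ≤ k, V is a quotient of S. Otherwise t = k + j + 1 with j + 1
  -- ≤ k, since two generators bound the length of V by 2k, and V ≅ S × S₀^(j+1).
  by_cases htk : t ≤ k
  · obtain ⟨g, hg⟩ := key t htk
    refine .inl ⟨eV.symm (g 1), eq_top_iff.2 fun u _ => ?_⟩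
    obtain ⟨x, hx⟩ := hg (eV u)
    rw [Submodule.mem_span_singleton]
    exact ⟨x, by rw [← map_smul, ← map_smul, ← span_one, hx, eV.symm_apply_apply]⟩
  · obtain ⟨j, rfl⟩ := Nat.exists_eq_add_of_lt (not_le.1 htk)
    have hlen : k + j + 1 ≤ k + k := by
      have hsurj : Function.Surjective
          ((LinearMap.toSpanSingleton S V v).coprod (LinearMap.toSpanSingleton S V w)) := by
        intro u
        obtain ⟨x, y, h⟩ := Submodule.mem_span_pair.1 (hvw ▸ Submodule.mem_top : u ∈ _)
        exact ⟨(x, y), by simpa using h⟩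
      have h1 := Module.length_le_of_surjective _ hsurj
      rw [Module.length_prod, eV.length_eq, eS.length_eq, Module.length_pi_of_fintype,
        Module.length_pi_of_fintype] at h1
      simp only [Module.length_eq_one, Finset.sum_const, Finset.card_univ, Fintype.card_fin,
        nsmul_eq_mul, mul_one] at h1
      exact_mod_cast h1
    obtain ⟨g, hg⟩ := key (j + 1) (by omega)
    let e : V ≃ₗ[S] S × (Fin (j + 1) → S₀) :=
      eV.trans <| (LinearEquiv.funCongrLeft S S₀
        (finSumFinEquiv (m := k) (n := j + 1))).trans <|
        (LinearEquiv.sumArrowLequivProdArrow (Fin k) (Fin (j + 1)) S S₀).trans <|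
          eS.symm.prodCongr (LinearEquiv.refl S _)
    refine .inr ⟨e.symm (1, 0), e.symm (0, g 1), ?_, eq_top_iff.2 fun u _ => ?_, fun x y h => ?_⟩
    · intro h
      have h1 : g 1 = 0 := by simpa using h
      have : Subsingleton (Fin (j + 1) → S₀) := ⟨fun a b => by
        obtain ⟨x, rfl⟩ := hg a
        obtain ⟨y, rfl⟩ := hg b
        rw [span_one x, span_one y, map_smul, map_smul, h1, smul_zero, smul_zero]⟩
      have := IsSimpleModule.nontrivial S S₀
      exact not_subsingleton (Fin (j + 1) → S₀) ‹_›
    · obtain ⟨y, hy⟩ := hg (e u).2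
      rw [Submodule.mem_span_pair]
      refine ⟨(e u).1, y, e.injective ?_⟩
      ext1 <;> simp [← hy, ← map_smul]
    · have h1 := congrArg e h
      simp only [map_add, map_smul, LinearEquiv.apply_symm_apply, map_zero, Prod.smul_mk,
        Prod.mk_add_mk, smul_zero, zero_add, add_zero, Prod.mk_eq_zero, smul_eq_mul, mul_one, mul_zero] at h1
      exact ⟨h1.1, by rw [← map_smul]; simp [h1.2]⟩

end Semisimple

/-! ### Nakayama's lemma -/

section Nakayama

variable {R : Type*} [Ring R] {X : Type*} [AddCommGroup X] [Module R X]

theorem Submodule.FG.le_of_le_sup_jacobson_smul {I : Ideal R} (hI : I ≤ Ring.jacobson R)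
    {N N' : Submodule R X} (hN : N.FG) (h : N ≤ N' ⊔ I • N) : N ≤ N' := by
  have h1 : N.map N'.mkQ = ⊥ := by
    refine (hN.map _).eq_bot_of_le_jacobson_smul ?_
    calc N.map N'.mkQ ≤ (N' ⊔ I • N).map N'.mkQ := Submodule.map_mono h
      _ = I • N.map N'.mkQ := by
        rw [Submodule.map_sup, Submodule.map_smul'', Submodule.mkQ_map_self, bot_sup_eq]
      _ ≤ _ := Submodule.smul_mono_left hI
  rw [← LinearMap.le_ker_iff_map, Submodule.ker_mkQ] at h1
  exact h1

end Nakayama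

/-! ### Finitely generated submodules of A are cyclic -/

section Bezout

variable {A : Type*} [Ring A] [IsSimpleRing A] [IsArtinianRing A]
variable {R : Subring A} {M : Ideal R} [M.IsTwoSided]
variable [IsSimpleRing (R ⧸ M)] [IsArtinianRing (R ⧸ M)]

/-- By Nakayama it suffices that N/MN be cyclic over R/M. Otherwise it is the direct sum of a free
module on a and a nonzero cyclic module on b; then a is a unit of A, and the Dubrovin condition for
ba⁻¹ contradicts directness. -/
theorem IsDubrovinPair.exists_span_pair_eq (h : IsDubrovinPair R M) (a₀ b₀ : A) :
    ∃ z : A, Submodule.span R {a₀, b₀} = Submodule.span R {z} := by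
  set N : Submodule R A := Submodule.span R {a₀, b₀} with hN
  have hfg : N.FG := Submodule.fg_span (Set.toFinite _)
  have hM : M ≤ Ring.jacobson R := h.eq_jacobson.le
  let π : N →ₗ[R] N ⧸ (M • ⊤ : Submodule R N) := Submodule.mkQ _
  have hπ : Function.Surjective π := Submodule.mkQ_surjective _
  have hsmul : ∀ (r : R) (n : N), π (r • n) = Ideal.Quotient.mk M r • π n := fun r n => rfl
  have hker : ∀ n : N, π n = 0 ↔ (n : A) ∈ M • N := fun n => by
    rw [← Submodule.mem_smul_top_iff, ← LinearMap.mem_ker, Submodule.ker_mkQ]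
  have hspan : ∀ s : Set N, Submodule.span (R ⧸ M) (π '' s) = ⊤ →
      N = Submodule.span R ((↑) '' s) := fun s hs => by
    refine le_antisymm (hfg.le_of_le_sup_jacobson_smul hM fun n hn => ?_)
      (Submodule.span_le.2 (by rintro _ ⟨x, -, rfl⟩; exact x.2))
    have key : ∀ v ∈ Submodule.span (R ⧸ M) (π '' s), ∃ x ∈ Submodule.span R s, π x = v := by
      intro v hv
      induction hv using Submodule.span_induction with
      | mem v hv => obtain ⟨x, hx, rfl⟩ := hv; exact ⟨x, Submodule.subset_span hx, rfl⟩
      | zero => exact ⟨0, zero_mem _, map_zero _⟩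
      | add v w _ _ hv hw =>
        obtain ⟨x, hx, rfl⟩ := hv
        obtain ⟨y, hy, rfl⟩ := hw
        exact ⟨x + y, add_mem hx hy, map_add _ _ _⟩
      | smul c v _ hv =>
        obtain ⟨x, hx, rfl⟩ := hv
        obtain ⟨r, rfl⟩ := Ideal.Quotient.mk_surjective c
        exact ⟨r • x, Submodule.smul_mem _ _ hx, hsmul r x⟩
    obtain ⟨x, hx, hxn⟩ := key (π ⟨n, hn⟩) (hs ▸ Submodule.mem_top)
    rw [show n = (x : A) + (n - x) by abel]
    refine Submodule.add_mem_sup ?_ ((hker (⟨n, hn⟩ - x)).1 (by rw [map_sub, hxn, sub_self]))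
    have := Submodule.mem_map_of_mem (f := N.subtype) hx
    rwa [Submodule.map_span] at this
  have ha₀ : a₀ ∈ N := Submodule.subset_span (by simp)
  have hb₀ : b₀ ∈ N := Submodule.subset_span (by simp)
  have hgen : Submodule.span (R ⧸ M) {π ⟨a₀, ha₀⟩, π ⟨b₀, hb₀⟩} = ⊤ := by
    refine eq_top_iff.2 fun v _ => ?_
    obtain ⟨⟨n, hn⟩, rfl⟩ := hπ v
    obtain ⟨x, y, rfl⟩ := Submodule.mem_span_pair.1 hn
    exact Submodule.mem_span_pair.2 ⟨Ideal.Quotient.mk M x, Ideal.Quotient.mk M y, rfl⟩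
  obtain ⟨u, hu⟩ | ⟨a', b', hb', hab, hrel⟩ :=
    IsSimpleRing.span_singleton_eq_top_or_of_span_pair hgen
  · obtain ⟨z, rfl⟩ := hπ u
    exact ⟨z, by simpa using hspan {z} (by simpa using hu)⟩
  · exfalso
    obtain ⟨a, rfl⟩ := hπ a'
    obtain ⟨b, rfl⟩ := hπ b'
    have hrel' : ∀ x y : R, (x : A) * a + y * b = 0 → x ∈ M ∧ π (y • b) = 0 := fun x y hxy => by
      have h1 : x • a + y • b = 0 := Subtype.coe_injective hxy
      have h2 := congrArg π h1
      rw [map_add, hsmul, hsmul, map_zero] at h2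
      exact ⟨Ideal.Quotient.eq_zero_iff_mem.1 (hrel _ _ h2).1, (hrel _ _ h2).2⟩
    obtain ⟨⟨a₁, a₂, h12, h21⟩, ha₁ : a₁ = (a : A)⟩ := h.isUnit_of_forall_mul_eq_zero
      (a := (a : A)) fun x hx => (hrel' x 0 (by simpa using hx)).1
    rw [ha₁] at h12 h21
    -- For q = ba⁻¹ in R, the relation qa - b = 0 kills b modulo MN. For q outside R, take x = rq
    -- outside M; then -xa + rb = 0 forces x ∈ M.
    by_cases hq : (b : A) * a₂ ∈ R
    · refine hb' ?_
      have := (hrel' ⟨_, hq⟩ (-1) (by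
        push_cast
        rw [mul_assoc, h21]; noncomm_ring)).2
      simpa using this
    · obtain ⟨r, x, hx, hxM⟩ := h.left _ hq
      have := (hrel' (-x) r (by
        push_cast
        rw [← hx, neg_mul, mul_assoc, mul_assoc, h21]; noncomm_ring)).1
      exact hxM (by simpa using this)

theorem IsDubrovinPair.exists_eq_span_singleton (h : IsDubrovinPair R M) {N : Submodule R A}
    (hN : N.FG) : ∃ z : A, N = Submodule.span R {z} := by
  induction N, hN using Submodule.fg_induction with
  | singleton x => exact ⟨x, rfl⟩
  | sup N₁ N₂ h₁ h₂ ih₁ ih₂ =>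
    obtain ⟨z₁, rfl⟩ := ih₁
    obtain ⟨z₂, rfl⟩ := ih₂
    obtain ⟨z, hz⟩ := h.exists_span_pair_eq z₁ z₂
    exact ⟨z, by rw [← hz, Submodule.span_insert]⟩

end Bezout

/-! ### Lengths and Artinian finiteness -/

section Lengths

theorem Submodule.length_lt_length_of_lt {R X : Type*} [Ring R] [AddCommGroup X] [Module R X]
    {N N' : Submodule R X} (h : N < N') (hN : Module.length R N ≠ ⊤) :
    Module.length R N < Module.length R N' := by
  rw [Module.length_submodule] at hN ⊢
  rw [Module.length_submodule]
  exact Order.height_strictMono h (lt_top_iff_ne_top.2 hN)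

theorem ENat.exists_max_of_forall_le {α : Type*} {p : α → Prop} {f : α → ℕ∞} {c : ℕ∞} (hc : c ≠ ⊤)
    (h₀ : ∃ a, p a) (hb : ∀ a, p a → f a ≤ c) : ∃ a, p a ∧ ∀ b, p b → f b ≤ f a := by
  by_contra! H
  have key : ∀ n : ℕ, ∃ a, p a ∧ n ≤ f a := fun n => by
    induction n with
    | zero => exact ⟨h₀.choose, h₀.choose_spec, by simp⟩
    | succ n ih =>
      obtain ⟨a, ha, hna⟩ := ih
      obtain ⟨b, hb, hab⟩ := H a ha
      exact ⟨b, hb, by simpa using Order.add_one_le_of_lt (hna.trans_lt hab)⟩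
  obtain ⟨n, rfl⟩ := ENat.ne_top_iff_exists.1 hc
  obtain ⟨a, ha, hna⟩ := key (n + 1)
  have := hna.trans (hb a ha)
  norm_cast at this
  omega

/-- A multiplicative injection of an Artinian ring into itself is unital. -/
theorem IsArtinianRing.map_one_of_injective {B : Type*} [Ring B] [IsArtinianRing B] (ψ : B → B)
    (hmul : ∀ x y, ψ (x * y) = ψ x * ψ y) (hinj : Function.Injective ψ) : ψ 1 = 1 := by
  -- Since ψ need not be additive, only the idempotents ψⁿ(1) are followed. They generate a
  -- descending chain of left ideals; stabilization gives `f n = f (n + 1)`, and injectivity carries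
  -- this back to n = 0.
  let f : ℕ → B := fun n => ψ^[n] 1
  have hf : ∀ n, f (n + 1) = ψ (f n) := fun n => Function.iterate_succ_apply' ψ n 1
  have h1 : ∀ n, f n * f (n + 1) = f (n + 1) ∧ f (n + 1) * f n = f (n + 1) := fun n => by
    induction n with
    | zero => simp [f]
    | succ n ih => rw [hf (n + 1), hf n, ← hmul, ← hmul, ← hf n, ih.1, ih.2]; exact ⟨rfl, rfl⟩
  obtain ⟨n, hn⟩ := IsArtinian.monotone_stabilizes (R := B) (M := B)
    ⟨fun n => OrderDual.toDual (Ideal.span {f n}), monotone_nat_of_le_succ fun n =>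
      OrderDual.toDual_le_toDual.2 <| Ideal.span_le.2 <| Set.singleton_subset_iff.2 <|
        Ideal.mem_span_singleton'.2 ⟨f (n + 1), (h1 n).2⟩⟩
  have h2 : f n ∈ Ideal.span {f (n + 1)} := by
    have : Ideal.span {f n} = Ideal.span {f (n + 1)} :=
      OrderDual.toDual.injective (hn (n + 1) (by omega))
    rw [← this]
    exact Ideal.mem_span_singleton_self _
  obtain ⟨c, hc⟩ := Ideal.mem_span_singleton'.1 h2
  have h3 : ∀ m, f (m + 1) * f (m + 1) = f (m + 1) := fun m => by
    have h11 : ψ 1 * ψ 1 = ψ 1 := by rw [← hmul, mul_one]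
    induction m with
    | zero => simpa [f] using h11
    | succ m ih => rw [hf (m + 1), ← hmul, ih]
  have h4 : f n = f (n + 1) := by
    rw [← (h1 n).1, ← hc, mul_assoc, h3]
  have h5 : ∀ m, f m = f (m + 1) → f 0 = f 1 := fun m => by
    induction m with
    | zero => exact id
    | succ m ih => exact fun h => ih (hinj (by rw [← hf, ← hf]; exact h))
  exact (h5 n h4).symm

theorem Ideal.length_quotient_ne_top {R : Type*} [Ring R] (M : Ideal R) [M.IsTwoSided]
    [IsArtinianRing (R ⧸ M)] : Module.length R (R ⧸ M) ≠ ⊤ := by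
  let l : (R ⧸ M) →ₛₗ[Ideal.Quotient.mk M] (R ⧸ M) :=
    { toFun := id, map_add' := fun _ _ => rfl, map_smul' := fun r x => by
        obtain ⟨x, rfl⟩ := Ideal.Quotient.mk_surjective x
        rfl }
  have : RingHomSurjective (Ideal.Quotient.mk M) := ⟨Ideal.Quotient.mk_surjective⟩
  have h1 : IsArtinian R (R ⧸ M) :=
    (l.isArtinian_iff_of_bijective Function.bijective_id).2 ‹IsArtinianRing (R ⧸ M)›
  have h2 : IsNoetherian R (R ⧸ M) :=
    (l.isNoetherian_iff_of_bijective Function.bijective_id).2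
      (inferInstanceAs (IsNoetherianRing (R ⧸ M)))
  exact Module.length_ne_top

theorem Module.length_le_length_quotient_of_span_singleton {R X : Type*} [Ring R] [AddCommGroup X]
    [Module R X] {I : Ideal R} {x : X} (hx : ∀ r ∈ I, r • x = 0)
    (hspan : Submodule.span R {x} = ⊤) : Module.length R X ≤ Module.length R (R ⧸ I) := by
  refine Module.length_le_of_surjective (I.liftQ (LinearMap.toSpanSingleton R X x) hx) fun y => ?_
  obtain ⟨r, rfl⟩ := Submodule.mem_span_singleton.1 (hspan ▸ Submodule.mem_top : y ∈ _)
  exact ⟨Submodule.Quotient.mk r, rfl⟩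

end Lengths

/-! ### A as the ring of fractions of R -/

section Fractions

variable {A : Type*} [Ring A] [IsSimpleRing A] [IsArtinianRing A]
variable {R : Subring A} {M : Ideal R} [M.IsTwoSided]
variable [IsSimpleRing (R ⧸ M)] [IsArtinianRing (R ⧸ M)]

instance {A : Type*} [Ring A] [IsSimpleRing A] [IsArtinianRing A] : IsArtinianRing Aᵐᵒᵖ :=
  have : IsSemisimpleRing A := IsSimpleRing.isSemisimpleRing_iff_isArtinianRing.2 inferInstance
  inferInstance

/-- The inclusion of a subring as a linear map over it. -/
def Subring.inclusionLinear (R : Subring A) : R →ₗ[R] A where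
  toFun := (↑)
  map_add' _ _ := rfl
  map_smul' _ _ := rfl

theorem IsDubrovinPair.exists_ideal_eq_span_singleton (h : IsDubrovinPair R M) {N : Ideal R}
    (hN : N.FG) : ∃ z : R, N = Ideal.span {z} := by
  obtain ⟨z, hz⟩ := h.exists_eq_span_singleton (Submodule.FG.map R.inclusionLinear hN)
  obtain ⟨w, hw, rfl⟩ := Submodule.mem_map.1
    (hz ▸ Submodule.mem_span_singleton_self z : z ∈ Submodule.map R.inclusionLinear N)
  refine ⟨w, Submodule.map_injective_of_injective (f := R.inclusionLinear)
    Subtype.coe_injective ?_⟩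
  rw [hz, Ideal.span, Submodule.map_span, Set.image_singleton]

/-- If R + Rq = Rz, then uz = 1 and yz = q with u, y ∈ R, so q = yu⁻¹. -/
theorem IsDubrovinPair.exists_right_fraction (h : IsDubrovinPair R M) (q : A) :
    ∃ y u : R, IsUnit (u : A) ∧ q * u = y := by
  obtain ⟨z, hz⟩ := h.exists_span_pair_eq 1 q
  obtain ⟨u, hu⟩ := Submodule.mem_span_singleton.1
    (hz ▸ Submodule.subset_span (by simp) : (1 : A) ∈ Submodule.span R {z})
  obtain ⟨y, hy⟩ := Submodule.mem_span_singleton.1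
    (hz ▸ Submodule.subset_span (by simp) : q ∈ Submodule.span R {z})
  replace hu : (u : A) * z = 1 := hu
  replace hy : (y : A) * z = q := hy
  refine ⟨y, u, IsUnit.of_mul_eq_one z hu, ?_⟩
  rw [← hy, mul_assoc, mul_eq_one_comm.1 hu, mul_one]

theorem IsDubrovinPair.exists_left_fraction (h : IsDubrovinPair R M) (q : A) :
    ∃ y u : R, IsUnit (u : A) ∧ u * q = y := by
  obtain ⟨y, u, hu, e⟩ := h.op.exists_right_fraction (.op q)
  exact ⟨⟨_, y.2⟩, ⟨_, u.2⟩, hu.unop, congrArg MulOpposite.unop e⟩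

/-- The left ideal `A I` of `A`, consisting of the fractions `u⁻¹ b` with `b ∈ I`. -/
def IsDubrovinPair.leftFractions (h : IsDubrovinPair R M) (I : Ideal R) : Ideal A where
  carrier := {x | ∃ u : R, IsUnit (u : A) ∧ ∃ b ∈ I, (u : A) * x = b}
  add_mem' := by
    rintro x₁ x₂ ⟨u₁, ⟨v₁, hv₁⟩, b₁, hb₁, h₁⟩ ⟨u₂, ⟨v₂, hv₂⟩, b₂, hb₂, h₂⟩
    obtain ⟨y, u, hu, e⟩ := h.exists_left_fraction (u₁ * (v₂⁻¹ : Aˣ))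
    refine ⟨u * u₁, by simpa using hu.mul (hv₁ ▸ v₁.isUnit), u * b₁ + y * b₂,
      I.add_mem (I.mul_mem_left _ hb₁) (I.mul_mem_left _ hb₂), ?_⟩
    have e' : (u : A) * u₁ = y * u₂ := by
      rw [← e, ← hv₂, mul_assoc, mul_assoc, Units.inv_mul, mul_one]
    push_cast
    rw [mul_add, mul_assoc, h₁, e', mul_assoc, h₂]
  zero_mem' := ⟨1, by simp, 0, I.zero_mem, by simp⟩
  smul_mem' := by
    rintro c x ⟨u, ⟨v, hv⟩, b, hb, h₁⟩
    obtain ⟨y, w, hw, e⟩ := h.exists_left_fraction (c * (v⁻¹ : Aˣ))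
    refine ⟨w, hw, y * b, I.mul_mem_left _ hb, ?_⟩
    push_cast
    rw [← h₁, ← e, ← hv, smul_eq_mul]
    simp [mul_assoc]

theorem IsDubrovinPair.coe_mem_leftFractions (h : IsDubrovinPair R M) {I : Ideal R} {b : R}
    (hb : b ∈ I) : (b : A) ∈ h.leftFractions I :=
  ⟨1, by simp, b, hb, by simp⟩

theorem IsDubrovinPair.exists_isUnit_mem_of_leftFractions_eq_top (h : IsDubrovinPair R M)
    {I : Ideal R} (hI : h.leftFractions I = ⊤) : ∃ b ∈ I, IsUnit (b : A) := by
  obtain ⟨u, hu, b, hb, e⟩ : (1 : A) ∈ h.leftFractions I := hI ▸ Submodule.mem_top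
  exact ⟨b, hb, by rwa [← e, mul_one]⟩

/-- W = AI is stable under right multiplication by R. For u ∈ R invertible in A, right
multiplication by u is injective on the Artinian module W, hence onto, so W is also stable under
u⁻¹. Thus W is a nonzero two-sided ideal of A and contains 1. -/
theorem IsDubrovinPair.exists_isUnit_mem (h : IsDubrovinPair R M) {I : Ideal R} [I.IsTwoSided]
    (hI : I ≠ ⊥) : ∃ b ∈ I, IsUnit (b : A) := by
  let W : Ideal A := h.leftFractions I
  have hWR : ∀ x ∈ W, ∀ s : R, x * s ∈ W := by
    rintro x ⟨u, hu, b, hb, h₁⟩ s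
    exact ⟨u, hu, b * s, Ideal.IsTwoSided.mul_mem_of_left s hb, by simp [← mul_assoc, h₁]⟩
  have hWu : ∀ u : R, IsUnit (u : A) → ∀ x ∈ W, ∃ y ∈ W, y * u = x := fun u hu x hx => by
    let g : W →ₗ[A] W := ((LinearMap.toSpanSingleton A A (u : A)).restrict fun x hx => hWR x hx u)
    obtain ⟨y, hy⟩ := IsArtinian.surjective_of_injective_endomorphism g (fun a b hab =>
      Subtype.coe_injective (hu.mul_right_cancel (congrArg Subtype.val hab))) ⟨x, hx⟩
    exact ⟨y, y.2, congrArg Subtype.val hy⟩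
  have hW : W.IsTwoSided := ⟨fun {x} q hx => by
    obtain ⟨y, u, hu, e⟩ := h.exists_right_fraction q
    obtain ⟨w, hw, e'⟩ := hWu u hu _ (hWR x hx y)
    rw [← e, ← mul_assoc] at e'
    rwa [← hu.mul_right_cancel e']⟩
  refine h.exists_isUnit_mem_of_leftFractions_eq_top <|
    Ideal.eq_top_of_isSimpleRing hW fun h0 => hI <|
      (Submodule.eq_bot_iff _).2 fun b hb => Subtype.coe_injective ?_
  have : (b : A) ∈ h.leftFractions I := h.coe_mem_leftFractions hb
  rw [h0] at this
  exact this

/-- If M = 0, then R is Artinian, so elements of R invertible in A are invertible in R and every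
fraction lies in R. -/
theorem IsDubrovinPair.ne_bot (h : IsDubrovinPair R M) (hne : R ≠ ⊤) : M ≠ ⊥ := by
  rintro rfl
  refine hne (eq_top_iff.2 fun q _ => ?_)
  have hart : IsArtinianRing R := (RingEquiv.quotientBot R).isArtinianRing
  obtain ⟨y, u, hu, e⟩ := h.exists_right_fraction q
  have : IsUnit u := IsArtinianRing.isUnit_of_forall_mul_eq_zero fun x hx =>
    Subtype.coe_injective (hu.mul_left_eq_zero.1 (by simpa using congrArg Subtype.val hx))
  obtain ⟨v, rfl⟩ := this
  have h1 : (↑v : R).1 * (↑v⁻¹ : R).1 = 1 := congrArg Subtype.val v.mul_inv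
  have : q = y * (↑v⁻¹ : R).1 := by rw [← e, mul_assoc, h1, mul_one]
  rw [this]
  exact R.mul_mem y.2 (↑v⁻¹ : R).2

end Fractions

/-! ### M is principal when M ≠ M² -/

section Principal

variable {A : Type*} [Ring A] [IsSimpleRing A] [IsArtinianRing A]
variable {R : Subring A} {M : Ideal R} [M.IsTwoSided]
variable [IsSimpleRing (R ⧸ M)] [IsArtinianRing (R ⧸ M)]

/-- A finitely generated N ≤ M is cyclic, so its image in M/M² is a quotient of R/M and has bounded
length. An N with longest image fills M modulo M². -/
theorem IsDubrovinPair.exists_eq_span_sup_mul_self (h : IsDubrovinPair R M) :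
    ∃ z ∈ M, M = Ideal.span {z} ⊔ M * M := by
  have hbound : ∀ N : Ideal R, N.FG ∧ N ≤ M →
      Module.length R (Submodule.map (M * M).mkQ N) ≤ Module.length R (R ⧸ M) := by
    rintro N ⟨hN, hNM⟩
    obtain ⟨z, rfl⟩ := h.exists_ideal_eq_span_singleton hN
    have hzM : z ∈ M := hNM (Ideal.mem_span_singleton_self z)
    rw [Ideal.span, Submodule.map_span, Set.image_singleton]
    refine Module.length_le_length_quotient_of_span_singleton
      (x := ⟨(M * M).mkQ z, Submodule.mem_span_singleton_self _⟩) (fun r hr => ?_)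
      (eq_top_iff.2 ?_)
    · exact Subtype.coe_injective ((Submodule.Quotient.mk_eq_zero _).2 (Ideal.mul_mem_mul hr hzM))
    · rintro ⟨v, hv⟩ -
      obtain ⟨r, rfl⟩ := Submodule.mem_span_singleton.1 hv
      exact Submodule.mem_span_singleton.2 ⟨r, rfl⟩
  obtain ⟨N, ⟨hN, hNM⟩, hmax⟩ := ENat.exists_max_of_forall_le
    (p := fun N : Ideal R => N.FG ∧ N ≤ M)
    (f := fun N => Module.length R (Submodule.map (M * M).mkQ N))
    (Ideal.length_quotient_ne_top M) ⟨⊥, Submodule.fg_bot, bot_le⟩ hbound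
  have hle : M ≤ N ⊔ M * M := fun y hy => by
    by_contra hyN
    have hlt : Submodule.map (M * M).mkQ N < Submodule.map (M * M).mkQ (N ⊔ Ideal.span {y}) := by
      refine lt_of_le_of_ne (Submodule.map_mono le_sup_left) fun heq => hyN ?_
      have h1 : (M * M).mkQ y ∈ Submodule.map (M * M).mkQ N :=
        heq ▸ Submodule.mem_map_of_mem (Submodule.mem_sup_right (Ideal.mem_span_singleton_self y))
      obtain ⟨n, hn, hny⟩ := h1
      rw [show y = n + (y - n) by abel]
      exact Submodule.add_mem_sup hn ((Submodule.Quotient.eq _).1 hny.symm)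
    have hp : (N ⊔ Ideal.span {y}).FG ∧ N ⊔ Ideal.span {y} ≤ M :=
      ⟨Submodule.FG.sup hN (Submodule.fg_span_singleton y), sup_le hNM (Ideal.span_le.2 (by simpa using hy))⟩
    have hfin : Module.length R (Submodule.map (M * M).mkQ N) ≠ ⊤ :=
      ne_top_of_le_ne_top (Ideal.length_quotient_ne_top M) (hbound N ⟨hN, hNM⟩)
    exact absurd (hmax _ hp) (not_le.2 (Submodule.length_lt_length_of_lt hlt hfin))
  obtain ⟨z, rfl⟩ := h.exists_ideal_eq_span_singleton hN
  exact ⟨z, hNM (Ideal.mem_span_singleton_self z), le_antisymm hle (sup_le hNM Ideal.mul_le_left)⟩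

/-- Let K ⊇ M annihilate z modulo M²; its image in R/M is generated by an idempotent e. Each zb is
congruent to some βz, and b ↦ β(1 - e) is a multiplicative injection of the Artinian ring R/M into
itself. It must fix 1, so e = 0 and K = M. -/
theorem Ideal.mem_of_mul_mem_mul_self {R : Type*} [Ring R] {M : Ideal R} [M.IsTwoSided]
    [IsSimpleRing (R ⧸ M)] [IsArtinianRing (R ⧸ M)] (hM : M ≠ M * M) {z : R} (hz : z ∈ M)
    (hspan : M = Ideal.span {z} ⊔ M * M) {a : R} (ha : a * z ∈ M * M) : a ∈ M := by
  have hMz : ∀ b : R, b ∈ M ↔ ∃ β, ∃ s ∈ M * M, β * z + s = b := fun b => by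
    conv_lhs => rw [hspan]
    exact Ideal.mem_span_singleton_sup
  have hM2 : ∀ {s : R} (b : R), s ∈ M * M → s * b ∈ M * M :=
    fun b hs => Ideal.IsTwoSided.mul_mem_of_left b hs
  let K : Ideal R := Submodule.comap (LinearMap.toSpanSingleton R R z) (M * M)
  have hK : ∀ a, a ∈ K ↔ a * z ∈ M * M := fun a => Iff.rfl
  have hMK : M ≤ K := fun x hx => Ideal.mul_mem_mul hx hz
  have hss : IsSemisimpleRing (R ⧸ M) := IsSimpleRing.isSemisimpleRing_iff_isArtinianRing.2 ‹_›
  obtain ⟨e', he, hKe⟩ := IsSemisimpleRing.ideal_eq_span_idempotent (K.map (Ideal.Quotient.mk M))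
  obtain ⟨e, rfl⟩ := Ideal.Quotient.mk_surjective e'
  have hmk : ∀ a, a ∈ K ↔ Ideal.Quotient.mk M a * Ideal.Quotient.mk M e = Ideal.Quotient.mk M a :=
    fun a => by
      have h1 : a ∈ K ↔ Ideal.Quotient.mk M a ∈ K.map (Ideal.Quotient.mk M) := by
        refine ⟨Ideal.mem_map_of_mem _, fun h => ?_⟩
        obtain ⟨b, hb, hba⟩ := (Ideal.mem_map_iff_of_surjective _ Ideal.Quotient.mk_surjective).1 h
        rw [← sub_add_cancel a b]
        exact K.add_mem (hMK (Ideal.Quotient.eq.1 hba.symm)) hb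
      rw [h1, hKe, Ideal.mem_span_singleton']
      refine ⟨?_, fun h => ⟨_, h⟩⟩
      rintro ⟨c, hc⟩
      rw [← hc, mul_assoc, he.eq]
  have heK : e ∈ K := (hmk e).2 he
  have hex : ∀ b : R, ∃ β, z * b - β * z ∈ M * M := fun b => by
    obtain ⟨β, s, hs, e⟩ := (hMz (z * b)).1 (Ideal.IsTwoSided.mul_mem_of_left b hz)
    exact ⟨β, by rwa [← e, add_sub_cancel_left]⟩
  choose β hβ using hex
  let ψ : R ⧸ M → R ⧸ M := fun x =>
    Ideal.Quotient.mk M (β x.out) * (1 - Ideal.Quotient.mk M e)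
  have hψ : ∀ b γ : R, z * b - γ * z ∈ M * M →
      ψ (Ideal.Quotient.mk M b) = Ideal.Quotient.mk M γ * (1 - Ideal.Quotient.mk M e) := by
    intro b γ hγ
    set c : R := (Ideal.Quotient.mk M b).out with hc
    have hcb : c - b ∈ M := Ideal.Quotient.eq.1 (Ideal.Quotient.mk_out _)
    have h1 : β c - γ ∈ K := by
      rw [hK]
      have : (β c - γ) * z = (z * b - γ * z) - (z * c - β c * z) + z * (c - b) := by noncomm_ring
      rw [this]
      exact add_mem (sub_mem hγ (hβ c)) (Ideal.mul_mem_mul hz hcb)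
    have h2 := (hmk _).1 h1
    rw [map_sub] at h2
    change Ideal.Quotient.mk M (β c) * _ = _
    rw [← sub_eq_zero, ← sub_mul, mul_sub, mul_one, h2, sub_self]
  have hsurj : ∀ x : R ⧸ M, ∃ b, Ideal.Quotient.mk M b = x := Ideal.Quotient.mk_surjective
  have hmul : ∀ x y, ψ (x * y) = ψ x * ψ y := by
    intro x y
    obtain ⟨b, rfl⟩ := hsurj x
    obtain ⟨c, rfl⟩ := hsurj y
    rw [← map_mul, hψ b _ (hβ b), hψ c _ (hβ c), hψ (b * c) (β b * β c), map_mul]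
    -- Modulo M², e(β c)z agrees with (ez)c, which is zero; this kills the cross term in the
    -- product.
    · have h1 : e * β c ∈ K := by
        rw [hK]
        have : e * β c * z = e * z * c - e * (z * c - β c * z) := by noncomm_ring
        rw [this]
        exact sub_mem (hM2 c heK) (Ideal.mul_mem_left _ _ (hβ c))
      have h2 := (hmk _).1 h1
      rw [map_mul] at h2
      have h3 : Ideal.Quotient.mk M e * Ideal.Quotient.mk M (β c) * (1 - Ideal.Quotient.mk M e) = 0 := by
        rw [mul_sub, h2, mul_one, sub_self]
      generalize Ideal.Quotient.mk M e = e at *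
      generalize Ideal.Quotient.mk M (β c) = y at *
      generalize Ideal.Quotient.mk M (β b) = x at *
      calc x * y * (1 - e) = x * (1 - e) * (y * (1 - e)) + x * (e * y * (1 - e)) := by noncomm_ring
        _ = _ := by rw [h3, mul_zero, add_zero]
    · have : z * (b * c) - β b * β c * z = (z * b - β b * z) * c + β b * (z * c - β c * z) := by
        noncomm_ring
      rw [this]
      exact add_mem (hM2 c (hβ b)) (Ideal.mul_mem_left _ _ (hβ c))
  -- The right annihilator Q of M/M² is two-sided and contains M. If it were larger, it would be R,
  -- forcing M = M².
  have hann : ∀ b : R, z * b ∈ M * M → b ∈ M := by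
    let Q : Ideal R :=
      { carrier := {b | ∀ m ∈ M, m * b ∈ M * M}
        add_mem' := fun ha hb m hm => by rw [mul_add]; exact add_mem (ha m hm) (hb m hm)
        zero_mem' := fun m _ => by rw [mul_zero]; exact zero_mem _
        smul_mem' := fun c x hx m hm => by
          rw [smul_eq_mul, ← mul_assoc]
          exact hx _ (Ideal.IsTwoSided.mul_mem_of_left c hm) }
    have hQ : Q.IsTwoSided := ⟨fun {x} b hx m hm => by
      rw [← mul_assoc]; exact hM2 b (hx m hm)⟩
    intro b hb
    have hbQ : b ∈ Q := fun m hm => by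
      obtain ⟨γ, s, hs, rfl⟩ := (hMz m).1 hm
      rw [add_mul, mul_assoc]
      exact add_mem (Ideal.mul_mem_left _ _ hb) (hM2 b hs)
    by_contra hbM
    have := Ideal.eq_top_of_not_le (M := M) (I := Q) fun hle => hbM (hle hbQ)
    have hMQ : M ≤ Q := fun x hx m hm => Ideal.mul_mem_mul hm hx
    rw [sup_eq_left.2 hMQ, Ideal.eq_top_iff_one] at this
    refine hM (le_antisymm (fun m hm => ?_) Ideal.mul_le_left)
    simpa using this m hm
  have hinj : Function.Injective ψ := by
    intro x y hxy
    obtain ⟨b, rfl⟩ := hsurj x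
    obtain ⟨c, rfl⟩ := hsurj y
    rw [hψ b _ (hβ b), hψ c _ (hβ c), ← sub_eq_zero, ← sub_mul, ← map_sub, mul_sub, mul_one,
      sub_eq_zero] at hxy
    have h1 : (β b - β c) * z ∈ M * M := (hmk _).2 hxy.symm
    refine Ideal.Quotient.eq.2 (hann _ ?_)
    have : z * (b - c) = (z * b - β b * z) - (z * c - β c * z) + (β b - β c) * z := by noncomm_ring
    rw [this]
    exact add_mem (sub_mem (hβ b) (hβ c)) h1
  have h1 := IsArtinianRing.map_one_of_injective ψ hmul hinj
  rw [← map_one (Ideal.Quotient.mk M), hψ 1 1 (by simp), map_one, one_mul, sub_eq_self] at h1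
  have h2 := (hmk a).1 ha
  rw [h1, mul_zero] at h2
  exact Ideal.Quotient.eq_zero_iff_mem.1 h2.symm

/-- Write Rz + Ry = Rw, z = cw and w = gz + s with s ∈ M². Then (1 - cg)z ∈ M², so cg, and hence gc,
is 1 modulo M. Thus gc is left invertible in R, and w, y ∈ Rz. -/
theorem IsDubrovinPair.exists_eq_span (h : IsDubrovinPair R M) (hM : M ≠ M * M) :
    ∃ p : R, M = Ideal.span {p} := by
  obtain ⟨z, hz, hspan⟩ := h.exists_eq_span_sup_mul_self
  refine ⟨z, le_antisymm (fun y hy => ?_) (Ideal.span_le.2 (by simpa using hz))⟩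
  obtain ⟨w, hw⟩ := h.exists_ideal_eq_span_singleton
    ((Submodule.fg_span_singleton (R := R) z).sup (Submodule.fg_span_singleton y))
  have hwM : w ∈ M := by
    have : w ∈ Ideal.span {z} ⊔ Ideal.span {y} := hw ▸ Ideal.mem_span_singleton_self w
    obtain ⟨a, b, hb, rfl⟩ := Ideal.mem_span_singleton_sup.1 this
    exact M.add_mem (M.mul_mem_left _ hz) ((Ideal.span_le (I := M)).2 (by simpa using hy) hb)
  obtain ⟨c, hc⟩ := Ideal.mem_span_singleton'.1
    (hw ▸ Submodule.mem_sup_left (Ideal.mem_span_singleton_self z) : z ∈ Ideal.span {w})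
  obtain ⟨d, hd⟩ := Ideal.mem_span_singleton'.1
    (hw ▸ Submodule.mem_sup_right (Ideal.mem_span_singleton_self y) : y ∈ Ideal.span {w})
  rw [hspan, Ideal.mem_span_singleton_sup] at hwM
  obtain ⟨g, s, hs, hgs⟩ := hwM
  have h1 : 1 - c * g ∈ M := Ideal.mem_of_mul_mem_mul_self hM hz hspan (by
    have : (1 - c * g) * z = c * s := by
      have hz' : z - c * (g * z + s) = 0 := by rw [hgs, hc, sub_self]
      rw [← sub_eq_zero, ← hz']; noncomm_ring
    rw [this]
    exact Ideal.mul_mem_left _ _ hs)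
  have h2 : 1 - g * c ∈ M := by
    have h3 : Ideal.Quotient.mk M c * Ideal.Quotient.mk M g = 1 := by
      rw [← map_mul, ← map_one (Ideal.Quotient.mk M)]
      exact (Ideal.Quotient.eq.2 h1).symm
    have h4 := mul_eq_one_comm.1 h3
    rw [← map_mul, ← map_one (Ideal.Quotient.mk M)] at h4
    exact Ideal.Quotient.eq.1 h4.symm
  obtain ⟨u, hu⟩ := h.exists_mul_one_sub h2
  rw [sub_sub_cancel] at hu
  refine Ideal.mem_span_singleton'.2 ⟨d * (u * g), ?_⟩
  rw [← hc, mul_assoc, mul_assoc, ← mul_assoc g, ← mul_assoc u, hu, one_mul, hd]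

end Principal

/-! ### Normal generators and the intersection of the powers of M -/

section Normal

variable {A : Type*} [Ring A] {R : Subring A}

/-- The ideal `M` of the subring `R` of `A` is generated by the element `p`, which is a unit
of `A` and satisfies `R p = p R`. -/
structure IsNormalGenerator (M : Ideal R) (p : R) : Prop where
  isUnit : IsUnit (p : A)
  eq_span : M = Ideal.span {p}
  exists_mul_eq : ∀ r : R, ∃ r' : R, p * r = r' * p
  exists_mul_eq' : ∀ r : R, ∃ r' : R, r * p = p * r'

/-- The opposite ring supplies M = gR. With g = cp, crp ∈ M = cpR, and cancelling c, a unit of A,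
gives rp ∈ pR. -/
theorem IsDubrovinPair.isNormalGenerator [IsSimpleRing A] [IsArtinianRing A] {M : Ideal R}
    [M.IsTwoSided] [IsSimpleRing (R ⧸ M)] [IsArtinianRing (R ⧸ M)] (h : IsDubrovinPair R M)
    (hM : M ≠ ⊥) {p : R} (hp : M = Ideal.span {p}) {p' : R.op}
    (hp' : Subring.opIdeal M = Ideal.span {p'}) : IsNormalGenerator M p := by
  obtain ⟨b, hb, hbu⟩ := h.exists_isUnit_mem hM
  have hmem : ∀ x, x ∈ M ↔ ∃ r, r * p = x := fun x => by
    rw [← Ideal.mem_span_singleton', ← hp]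
  let g : R := ⟨p'.1.unop, p'.2⟩
  have hmem' : ∀ x, x ∈ M ↔ ∃ r, g * r = x := fun x => by
    have h1 : x ∈ M ↔ (⟨.op x.1, x.2⟩ : R.op) ∈ Subring.opIdeal M := Iff.rfl
    rw [h1, hp', Ideal.mem_span_singleton']
    constructor
    · rintro ⟨r, hr⟩
      exact ⟨⟨r.1.unop, r.2⟩, Subtype.coe_injective
        (congrArg (fun y : R.op => y.1.unop) hr)⟩
    · rintro ⟨r, rfl⟩
      exact ⟨⟨.op r.1, r.2⟩, rfl⟩
  have hpu : IsUnit (p : A) := by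
    obtain ⟨r, rfl⟩ := (hmem b).1 hb
    exact isUnit_of_mul_isUnit_right (by simpa using hbu)
  have hgu : IsUnit (g : A) := by
    obtain ⟨r, rfl⟩ := (hmem' b).1 hb
    exact isUnit_of_mul_isUnit_left (by simpa using hbu)
  have hpM : p ∈ M := (hmem p).2 ⟨1, one_mul p⟩
  have hgM : g ∈ M := (hmem' g).2 ⟨1, mul_one g⟩
  refine ⟨hpu, hp, fun r => ?_, fun r => ?_⟩
  · obtain ⟨r', hr'⟩ := (hmem _).1 (Ideal.IsTwoSided.mul_mem_of_left r hpM)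
    exact ⟨r', hr'.symm⟩
  · obtain ⟨c, hc⟩ := (hmem g).1 hgM
    obtain ⟨d, hd⟩ := (hmem' (c * r * p)).1 (M.mul_mem_left _ hpM)
    have hcu : IsUnit (c : A) := isUnit_of_mul_isUnit_left (y := (p : A)) (by
      rw [← hc] at hgu
      simpa using hgu)
    refine ⟨d, Subtype.coe_injective (hcu.mul_left_cancel ?_)⟩
    rw [← hc] at hd
    simpa [mul_assoc] using (congrArg Subtype.val hd).symm

theorem Ideal.mem_or_mem_of_isSimpleRing_quotient {R : Type*} [Ring R] {M : Ideal R}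
    [M.IsTwoSided] [IsSimpleRing (R ⧸ M)] {a b : R} (hab : ∀ r, a * r * b ∈ M) :
    a ∈ M ∨ b ∈ M := by
  by_contra! hcon
  let Q : Ideal R :=
    { carrier := {b | ∀ r, a * r * b ∈ M}
      add_mem' := fun hx hy r => by rw [mul_add]; exact M.add_mem (hx r) (hy r)
      zero_mem' := fun r => by rw [mul_zero]; exact M.zero_mem
      smul_mem' := fun c x hx r => by
        rw [smul_eq_mul, ← mul_assoc, mul_assoc a]
        exact hx (r * c) }
  have hQ : Q.IsTwoSided := ⟨fun c hx r => by
    rw [← mul_assoc]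
    exact Ideal.IsTwoSided.mul_mem_of_left c (hx r)⟩
  have := Ideal.eq_top_of_not_le (M := M) (I := Q) fun hle => hcon.2 (hle hab)
  rw [sup_eq_left.2 fun m hm r => M.mul_mem_left _ hm, Ideal.eq_top_iff_one] at this
  exact hcon.1 (by simpa using this 1)

namespace IsNormalGenerator

variable {M : Ideal R} {p : R}

theorem exists_pow_mul_eq (hp : IsNormalGenerator M p) (n : ℕ) (r : R) :
    ∃ r' : R, p ^ n * r = r' * p ^ n := by
  induction n with
  | zero => exact ⟨r, by simp⟩
  | succ n ih =>
    obtain ⟨r', hr'⟩ := ih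
    obtain ⟨r'', hr''⟩ := hp.exists_mul_eq r'
    exact ⟨r'', by rw [pow_succ', mul_assoc, hr', ← mul_assoc, hr'', mul_assoc]⟩

theorem exists_mul_pow_eq (hp : IsNormalGenerator M p) (n : ℕ) (r : R) :
    ∃ r' : R, r * p ^ n = p ^ n * r' := by
  induction n with
  | zero => exact ⟨r, by simp⟩
  | succ n ih =>
    obtain ⟨r', hr'⟩ := ih
    obtain ⟨r'', hr''⟩ := hp.exists_mul_eq' r'
    exact ⟨r'', by rw [pow_succ, ← mul_assoc, hr', mul_assoc, hr'', mul_assoc]⟩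

theorem mem_pow [M.IsTwoSided] (hp : IsNormalGenerator M p) (n : ℕ) {x : R} :
    x ∈ M ^ n ↔ ∃ r, r * p ^ n = x := by
  obtain ⟨-, rfl, -, -⟩ := hp
  rw [Ideal.span_singleton_pow, Ideal.mem_span_singleton']

theorem mem_pow' [M.IsTwoSided] (hp : IsNormalGenerator M p) (n : ℕ) {x : R} :
    x ∈ M ^ n ↔ ∃ r, p ^ n * r = x := by
  rw [hp.mem_pow]
  constructor
  · rintro ⟨r, rfl⟩
    obtain ⟨r', hr'⟩ := hp.exists_mul_pow_eq n r
    exact ⟨r', hr'.symm⟩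
  · rintro ⟨r, rfl⟩
    obtain ⟨r', hr'⟩ := hp.exists_pow_mul_eq n r
    exact ⟨r', hr'.symm⟩

theorem mem (hp : IsNormalGenerator M p) : p ∈ M := hp.eq_span ▸ Ideal.mem_span_singleton_self p

theorem isUnit_pow (hp : IsNormalGenerator M p) (n : ℕ) : IsUnit ((p ^ n : R) : A) := by
  simpa using hp.isUnit.pow n

theorem pow_mul_left_cancel (hp : IsNormalGenerator M p) (n : ℕ) {x y : R}
    (h : p ^ n * x = p ^ n * y) : x = y :=
  Subtype.coe_injective ((hp.isUnit_pow n).mul_left_cancel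
    (by simpa using congrArg Subtype.val h))

theorem mul_pow_right_cancel (hp : IsNormalGenerator M p) (n : ℕ) {x y : R}
    (h : x * p ^ n = y * p ^ n) : x = y :=
  Subtype.coe_injective ((hp.isUnit_pow n).mul_right_cancel
    (by simpa using congrArg Subtype.val h))

theorem _root_.Ideal.isTwoSided_iInf_pow {R : Type*} [Ring R] (M : Ideal R) [M.IsTwoSided] :
    (⨅ n : ℕ, M ^ n).IsTwoSided :=
  ⟨fun b ha => by
    rw [Ideal.mem_iInf] at ha ⊢
    exact fun n => Ideal.IsTwoSided.mul_mem_of_left b (ha n)⟩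

theorem mem_iInf_of_mul_pow_mem [M.IsTwoSided] (hp : IsNormalGenerator M p) (n : ℕ) {x : R}
    (hx : x * p ^ n ∈ ⨅ n : ℕ, M ^ n) :
    x ∈ ⨅ n : ℕ, M ^ n := by
  rw [Ideal.mem_iInf] at hx ⊢
  intro m
  obtain ⟨r, hr⟩ := (hp.mem_pow _).1 (hx (m + n))
  rw [pow_add, ← mul_assoc] at hr
  exact (hp.mem_pow m).2 ⟨r, hp.mul_pow_right_cancel n hr⟩

theorem mem_iInf_of_pow_mul_mem [M.IsTwoSided] (hp : IsNormalGenerator M p) (n : ℕ) {x : R}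
    (hx : p ^ n * x ∈ ⨅ n : ℕ, M ^ n) :
    x ∈ ⨅ n : ℕ, M ^ n := by
  rw [Ideal.mem_iInf] at hx ⊢
  intro m
  obtain ⟨r, hr⟩ := (hp.mem_pow' _).1 (hx (n + m))
  rw [pow_add, mul_assoc] at hr
  exact (hp.mem_pow' m).2 ⟨r, hp.pow_mul_left_cancel n hr⟩

theorem exists_eq_pow_mul_of_notMem [M.IsTwoSided] (hp : IsNormalGenerator M p) {x : R}
    (hx : x ∉ ⨅ n : ℕ, M ^ n) :
    ∃ n y, x = p ^ n * y ∧ y ∉ M := by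
  classical
  rw [Ideal.mem_iInf] at hx
  push Not at hx
  -- `M ^ 0` is the whole ring, so the least power missing x has a predecessor containing it.
  have h0 : Nat.find hx ≠ 0 := fun h0 => Nat.find_spec hx (by
    rw [h0, Submodule.pow_zero, Ideal.one_eq_top]
    exact Submodule.mem_top)
  obtain ⟨n, hn⟩ := Nat.exists_eq_succ_of_ne_zero h0
  have h1 : x ∈ M ^ n := by
    by_contra h1
    exact Nat.find_min hx (by omega) h1
  obtain ⟨y, rfl⟩ := (hp.mem_pow' n).1 h1
  refine ⟨n, y, rfl, fun hy => Nat.find_spec hx ?_⟩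
  obtain ⟨z, rfl⟩ := (hp.mem_pow' 1).1 (by rwa [Submodule.pow_one] : y ∈ M ^ 1)
  rw [hn]
  exact (hp.mem_pow' _).2 ⟨z, by rw [pow_succ, pow_one, mul_assoc]⟩

/-- Strip the powers of p from a and b, leaving factors outside M; move the inner power to the left
and cancel. The primeness of M then gives the contradiction. -/
theorem mem_or_mem_of_forall_mul_mem [M.IsTwoSided] [IsSimpleRing (R ⧸ M)]
    (hp : IsNormalGenerator M p) {a b : R} (hab : ∀ r, a * r * b ∈ ⨅ n : ℕ, M ^ n) :
    a ∈ ⨅ n : ℕ, M ^ n ∨ b ∈ ⨅ n : ℕ, M ^ n := by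
  by_contra! hcon
  obtain ⟨n, a, rfl, ha⟩ := hp.exists_eq_pow_mul_of_notMem hcon.1
  obtain ⟨m, b, rfl, hb⟩ := hp.exists_eq_pow_mul_of_notMem hcon.2
  obtain ⟨c, hc⟩ := hp.exists_mul_pow_eq m a
  have hcM : c ∉ M := fun hcM => ha <| by
    obtain ⟨d, rfl⟩ := (hp.mem_pow 1).1 (by rwa [Submodule.pow_one] : c ∈ M ^ 1)
    obtain ⟨d', hd'⟩ := hp.exists_pow_mul_eq m d
    rw [← mul_assoc, hd', pow_one, mul_assoc, ← pow_succ, pow_succ', ← mul_assoc] at hc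
    rw [hp.mul_pow_right_cancel m hc]
    exact M.mul_mem_left _ hp.mem
  refine (Ideal.mem_or_mem_of_isSimpleRing_quotient (a := c) (b := b) fun r => ?_).elim hcM hb
  obtain ⟨r', hr'⟩ := hp.exists_pow_mul_eq m r
  have h1 := hab r'
  rw [show p ^ n * a * r' * (p ^ m * b) = p ^ n * (a * (r' * p ^ m) * b) by noncomm_ring,
    ← hr',
    show a * (p ^ m * r) * b = p ^ m * (c * r * b) by rw [← mul_assoc a, hc]; noncomm_ring] at h1
  have h2 := hp.mem_iInf_of_pow_mul_mem m (hp.mem_iInf_of_pow_mul_mem n h1)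
  rw [← Submodule.pow_one M]
  exact Ideal.mem_iInf.1 h2 1

end IsNormalGenerator

end Normal

/-! ### Essential left ideals contain powers of p -/

section Essential

variable {A : Type*} [Ring A] [IsSimpleRing A] [IsArtinianRing A]
variable {R : Subring A} {M : Ideal R} [M.IsTwoSided]
variable [IsSimpleRing (R ⧸ M)] [IsArtinianRing (R ⧸ M)]

/-- If no power of `p` lies in `R s`, there is an element outside `M` which multiplies `s` into
`M s + M ^ n` for all `n`. -/
theorem IsDubrovinPair.exists_notMem_forall_mul_eq (h : IsDubrovinPair R M) {p : R}
    (hp : IsNormalGenerator M p) {s : R} (H : ∀ n, p ^ n ∉ Ideal.span {s}) :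
    ∃ y ∉ M, ∀ n, ∃ a ∈ M, ∃ b ∈ M ^ n, y * s = a * s + b := by
  -- The left ideals of those y with ys ∈ Ms + M^n decrease and contain M, so their images in R/M
  -- stabilize; it remains to see that none lies in M.
  let Y : ℕ → Ideal R := fun n =>
    { carrier := {y | ∃ a ∈ M, ∃ b ∈ M ^ n, y * s = a * s + b}
      add_mem' := by
        rintro y y' ⟨a, ha, b, hb, e⟩ ⟨a', ha', b', hb', e'⟩
        exact ⟨a + a', M.add_mem ha ha', b + b', add_mem hb hb', by
          rw [add_mul, e, e']; noncomm_ring⟩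
      zero_mem' := ⟨0, M.zero_mem, 0, zero_mem _, by simp⟩
      smul_mem' := by
        rintro c y ⟨a, ha, b, hb, e⟩
        exact ⟨c * a, M.mul_mem_left _ ha, c * b, Ideal.mul_mem_left _ _ hb, by
          rw [smul_eq_mul, mul_assoc, e]; noncomm_ring⟩ }
  have hMY : ∀ n, M ≤ Y n := fun n y hy => ⟨y, hy, 0, zero_mem _, by simp⟩
  have hanti : ∀ n, Y (n + 1) ≤ Y n := by
    rintro n y ⟨a, ha, b, hb, e⟩
    obtain ⟨c, rfl⟩ := (hp.mem_pow _).1 hb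
    exact ⟨a, ha, c * p ^ (n + 1), (hp.mem_pow n).2 ⟨c * p, by rw [pow_succ', mul_assoc]⟩, e⟩
  have hne : ∀ n, ∃ y ∈ Y n, y ∉ M := fun n => by
    obtain ⟨z, hz⟩ := h.exists_ideal_eq_span_singleton
      (Submodule.FG.sup (Submodule.fg_span_singleton (R := R) s)
        (Submodule.fg_span_singleton (p ^ n)))
    obtain ⟨c, hc⟩ := Ideal.mem_span_singleton'.1
      (hz ▸ Submodule.mem_sup_left (Ideal.mem_span_singleton_self s) : s ∈ Ideal.span {z})
    obtain ⟨d, hd⟩ := Ideal.mem_span_singleton'.1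
      (hz ▸ Submodule.mem_sup_right (Ideal.mem_span_singleton_self _) : p ^ n ∈ Ideal.span {z})
    obtain ⟨α, x, hx, hαx⟩ := Ideal.mem_span_singleton_sup.1
      (hz ▸ Ideal.mem_span_singleton_self z : z ∈ Ideal.span {s} ⊔ Ideal.span {p ^ n})
    obtain ⟨β, rfl⟩ := Ideal.mem_span_singleton'.1 hx
    by_contra! hcon
    -- If yc ∈ M, then ys = ycz with z ∈ Rs + Rp^n, so y ∈ `Y n` and hence y ∈ M.
    have hunit : IsUnit (Ideal.Quotient.mk M c) :=
      IsArtinianRing.isUnit_of_forall_mul_eq_zero fun y hy => by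
        obtain ⟨y, rfl⟩ := Ideal.Quotient.mk_surjective y
        rw [← map_mul, Ideal.Quotient.eq_zero_iff_mem] at hy
        refine Ideal.Quotient.eq_zero_iff_mem.2 (hcon y ⟨y * c * α, ?_, y * c * (β * p ^ n), ?_, ?_⟩)
        · exact Ideal.IsTwoSided.mul_mem_of_left α hy
        · rw [← mul_assoc]
          exact (hp.mem_pow n).2 ⟨_, rfl⟩
        · calc y * s = y * c * (α * s + β * p ^ n) := by rw [hαx, mul_assoc, hc]
            _ = _ := by noncomm_ring
    obtain ⟨g', hg'⟩ := hunit.exists_left_inv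
    obtain ⟨g, rfl⟩ := Ideal.Quotient.mk_surjective g'
    rw [← map_mul, ← map_one (Ideal.Quotient.mk M)] at hg'
    obtain ⟨u, hu⟩ := h.exists_mul_one_sub (Ideal.Quotient.eq.1 hg'.symm)
    rw [sub_sub_cancel] at hu
    refine H n (Ideal.mem_span_singleton'.2 ⟨d * (u * g), ?_⟩)
    rw [← hc, mul_assoc, mul_assoc, ← mul_assoc g, ← mul_assoc u, hu, one_mul, hd]
  obtain ⟨N, hN⟩ := IsArtinian.monotone_stabilizes (R := R ⧸ M) (M := R ⧸ M)
    ⟨fun n => OrderDual.toDual ((Y n).map (Ideal.Quotient.mk M)), monotone_nat_of_le_succ fun n =>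
      OrderDual.toDual_le_toDual.2 <| Ideal.map_mono (hanti n)⟩
  obtain ⟨y, hyN, hy⟩ := hne N
  refine ⟨y, hy, fun n => ?_⟩
  change y ∈ Y n
  obtain hn | hn := le_total n N
  · exact antitone_nat_of_succ_le hanti hn hyN
  · have h1 : (Y N).map (Ideal.Quotient.mk M) = (Y n).map (Ideal.Quotient.mk M) :=
      OrderDual.toDual.injective (hN n hn)
    obtain ⟨y', hy', e⟩ := (Ideal.mem_map_iff_of_surjective _ Ideal.Quotient.mk_surjective).1
      (h1 ▸ Ideal.mem_map_of_mem (Ideal.Quotient.mk M) hyN)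
    rw [← sub_add_cancel y y']
    exact add_mem (hMY n (Ideal.Quotient.eq.1 e.symm)) hy'

theorem Ideal.exists_sum_mul_mul_eq_one_sub {R : Type*} [Ring R] {M : Ideal R} [M.IsTwoSided]
    [IsSimpleRing (R ⧸ M)] {y : R} (hy : y ∉ M) :
    ∃ (k : ℕ) (c r : Fin k → R), ∃ m ∈ M, ∑ i, c i * y * r i = 1 - m := by
  let K : Ideal R := Ideal.span (Set.range fun r => y * r)
  have hK : K.IsTwoSided := ⟨fun {a} b ha => by
    induction ha using Submodule.span_induction with
    | mem x hx =>
      obtain ⟨r, rfl⟩ := hx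
      exact Ideal.subset_span ⟨r * b, by simp [mul_assoc]⟩
    | zero => rw [zero_mul]; exact K.zero_mem
    | add x z _ _ hx hz => rw [add_mul]; exact K.add_mem hx hz
    | smul c x _ hx => rw [smul_eq_mul, mul_assoc]; exact K.mul_mem_left c hx⟩
  have hyK : y ∈ K := Ideal.subset_span ⟨1, by simp⟩
  have := Ideal.eq_top_of_not_le (M := M) (I := K) fun hle => hy (hle hyK)
  rw [Ideal.eq_top_iff_one, Submodule.mem_sup] at this
  obtain ⟨x, hx, m, hm, e⟩ := this
  obtain ⟨k, c, g, hg⟩ := Submodule.mem_span_set'.1 hx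
  choose r hr using fun i => (g i).2
  refine ⟨k, c, r, m, hm, ?_⟩
  rw [← e, add_sub_cancel_right, ← hg]
  exact Finset.sum_congr rfl fun i _ => by rw [smul_eq_mul, ← hr i, mul_assoc]

theorem Ideal.exists_forall_mul_mem_of_essential {R : Type*} [Ring R] {I E : Ideal R}
    [I.IsTwoSided] (hI : I ≠ ⊤) (hIE : I ≤ E) (hE : ∀ x ∉ I, ∃ r, r * x ∉ I ∧ r * x ∈ E)
    {ι : Type*} (J : Finset ι) (d : ι → R) : ∃ x ∉ I, ∀ i ∈ J, x * d i ∈ E := by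
  classical
  induction J using Finset.induction_on with
  | empty => exact ⟨1, (Ideal.ne_top_iff_one I).1 hI, by simp⟩
  | insert j J hj ih =>
    obtain ⟨x, hx, hxJ⟩ := ih
    by_cases hxj : x * d j ∈ I
    · refine ⟨x, hx, fun i hi => ?_⟩
      obtain rfl | hi := Finset.mem_insert.1 hi
      exacts [hIE hxj, hxJ i hi]
    · obtain ⟨r, hr, hrE⟩ := hE _ hxj
      rw [← mul_assoc] at hr hrE
      refine ⟨r * x, fun hrx => hr (Ideal.IsTwoSided.mul_mem_of_left _ hrx), fun i hi => ?_⟩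
      obtain rfl | hi := Finset.mem_insert.1 hi
      · exact hrE
      · rw [mul_assoc]
        exact E.mul_mem_left _ (hxJ i hi)

/-- If no power of p lies in Rs, some y outside M has ys ∈ Ms + M^n for all n, and Σ cᵢyrᵢ = 1 - m.
With σ = s⁻¹ and Rz = Σ Rσrᵢ, this puts z⁻¹ in every p^nR, hence in I. Then 1 is an element of I
plus a combination of elements vᵢ with svᵢ ∈ I, and essentiality yields an x ∉ I with x = x·1 ∈ I.
-/
theorem IsDubrovinPair.exists_pow_mem_span_of_essential (h : IsDubrovinPair R M) {p : R}
    (hp : IsNormalGenerator M p) {s : R} (hs : IsUnit (s : A))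
    (hess : ∀ x ∉ ⨅ n : ℕ, M ^ n, ∃ r, r * x ∉ (⨅ n : ℕ, M ^ n) ∧
      r * x ∈ Ideal.span {s} ⊔ ⨅ n : ℕ, M ^ n) : ∃ n, p ^ n ∈ Ideal.span {s} := by
  by_contra! H
  obtain ⟨y, hyM, hy⟩ := h.exists_notMem_forall_mul_eq hp H
  obtain ⟨k, c, r, m, hm, hsum⟩ := Ideal.exists_sum_mul_mul_eq_one_sub hyM
  set I : Ideal R := ⨅ n : ℕ, M ^ n with hI
  have hItwo : I.IsTwoSided := Ideal.isTwoSided_iInf_pow M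
  have hIM : I ≤ M := (iInf_le _ 1).trans (Submodule.pow_one M).le
  obtain ⟨⟨s', σ, hsσ, hσs⟩, hs' : s' = (s : A)⟩ := hs
  subst hs'
  obtain ⟨z, hz⟩ := h.exists_eq_span_singleton
    (Submodule.fg_span (R := R) (Set.finite_range fun i => σ * (r i : A)))
  -- Substituting y = a + bp^nσ turns the sum into an identity between 1 minus an element of M and
  -- p^n times an element of Rz. Multiply by a left inverse and move it past p^n.
  have hpow : ∀ n, ∃ ω : R, ((p ^ n * ω : R) : A) * z = 1 := fun n => by
    obtain ⟨a, ha, b, hb, e⟩ := hy n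
    obtain ⟨b, rfl⟩ := (hp.mem_pow n).1 hb
    have hconj : ∀ i, ∃ e, p ^ n * e = c i * b * p ^ n := fun i =>
      (hp.mem_pow' n).1 ((hp.mem_pow n).2 ⟨_, rfl⟩)
    choose e' he' using hconj
    have hmem : ∑ i, e' i • (σ * (r i : A)) ∈ Submodule.span R {z} := hz ▸
      Submodule.sum_mem _ fun i _ => Submodule.smul_mem _ _ (Submodule.subset_span ⟨i, rfl⟩)
    obtain ⟨ω, hω⟩ := Submodule.mem_span_singleton.1 hmem
    have hm' : m + ∑ i, c i * a * r i ∈ M := M.add_mem hm <| M.sum_mem fun i _ =>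
      Ideal.IsTwoSided.mul_mem_of_left _ (M.mul_mem_left _ ha)
    obtain ⟨u, hu⟩ := h.exists_mul_one_sub hm'
    obtain ⟨u', hu'⟩ := hp.exists_mul_pow_eq n u
    refine ⟨u' * ω, ?_⟩
    have hyσ : (y : A) = a + b * p ^ n * σ := by
      have := congrArg (fun x : R => (x : A) * σ) e
      simpa [mul_assoc, hsσ, add_mul] using this
    have h1 : (1 - (m + ∑ i, c i * a * r i) : A) = p ^ n * ∑ i, e' i * (σ * (r i : A)) := by
      have h2 : ∀ i, (c i : A) * y * r i = c i * a * r i + p ^ n * (e' i * (σ * (r i : A))) :=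
        fun i => by
          have h3 : (p : A) ^ n * e' i = c i * b * p ^ n := by
            simpa using congrArg Subtype.val (he' i)
          rw [hyσ, ← mul_assoc (_ ^ n), h3]; noncomm_ring
      have h4 : ∑ i, (c i : A) * y * r i = 1 - m := by
        simpa using congrArg Subtype.val hsum
      rw [← sub_sub, ← h4, Finset.mul_sum, AddSubmonoidClass.coe_finsetSum,
        ← Finset.sum_sub_distrib]
      exact Finset.sum_congr rfl fun i _ => by push_cast; rw [h2 i, add_sub_cancel_left]
    have h5 : (ω : A) * z = ∑ i, e' i * (σ * (r i : A)) := hω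
    have hu'' : (u : A) * p ^ n = p ^ n * u' := by simpa using congrArg Subtype.val hu'
    have hu3 : (u : A) * (1 - (m + ∑ i, c i * a * r i)) = 1 := by
      simpa using congrArg Subtype.val hu
    push_cast
    rw [← mul_assoc, ← hu'', mul_assoc, mul_assoc, h5, ← h1, hu3]
  obtain ⟨v, hv⟩ : ∃ v : R, (v : A) * z = 1 := (hpow 0).imp' _ fun ω hω => hω
  have hzv := mul_eq_one_comm.1 hv
  have hvI : v ∈ I := by
    rw [hI, Ideal.mem_iInf]
    intro n
    obtain ⟨ω, hω⟩ := hpow n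
    refine (hp.mem_pow' n).2 ⟨ω, Subtype.coe_injective ?_⟩
    calc ((p ^ n * ω : R) : A) = (p ^ n * ω : R) * (z * v) := by rw [hzv, mul_one]
      _ = v := by rw [← mul_assoc, hω, one_mul]
  have hfg1 : (Submodule.span R {(1 : A)}).FG := Submodule.fg_span_singleton _
  have hfg2 : (Submodule.span R {z}).FG := Submodule.fg_span_singleton _
  -- As Rg contains 1, t = g⁻¹ lies in R, and z = wg gives t = vw ∈ I. Writing σrᵢ = vᵢg gives svᵢ =
  -- rᵢt ∈ I, and expanding g in R + Σ Rσrᵢ, then multiplying by t, expresses 1.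
  obtain ⟨g, hg⟩ := h.exists_eq_span_singleton (hfg1.sup hfg2)
  have hle : Submodule.span R {z} ≤ Submodule.span R {g} := hg ▸ le_sup_right
  obtain ⟨t, ht : (t : A) * g = 1⟩ := Submodule.mem_span_singleton.1
    (hg ▸ Submodule.mem_sup_left (Submodule.mem_span_singleton_self _) :
      (1 : A) ∈ Submodule.span R {g})
  have hgt := mul_eq_one_comm.1 ht
  obtain ⟨w, hw : (w : A) * g = z⟩ := Submodule.mem_span_singleton.1
    (hle (Submodule.mem_span_singleton_self _))
  have htI : t ∈ I := by
    have : t = v * w := Subtype.coe_injective <| by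
      calc (t : A) = v * z * t := by rw [hv, one_mul]
        _ = v * w * (g * t) := by rw [← hw]; noncomm_ring
        _ = _ := by rw [hgt, mul_one]; rfl
    rw [this]
    exact Ideal.IsTwoSided.mul_mem_of_left _ hvI
  have hex : ∀ i, ∃ v : R, (v : A) * g = σ * r i := fun i => Submodule.mem_span_singleton.1
    (hle (hz ▸ Submodule.subset_span ⟨i, rfl⟩))
  choose vr hvr using hex
  have hvr' : ∀ i, (vr i : A) = σ * r i * t := fun i => by rw [← hvr, mul_assoc, hgt, mul_one]
  have hsv : ∀ i, s * vr i ∈ I := fun i => by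
    have : s * vr i = r i * t := Subtype.coe_injective <| by
      push_cast
      rw [hvr', ← mul_assoc, ← mul_assoc, hsσ, one_mul]
    rw [this]
    exact I.mul_mem_left _ htI
  obtain ⟨d₀, hd₀, x, hx, hgx⟩ := Submodule.mem_sup.1
    (hg ▸ Submodule.mem_span_singleton_self g :
      g ∈ Submodule.span R {(1 : A)} ⊔ Submodule.span R {z})
  obtain ⟨d₀, rfl⟩ := Submodule.mem_span_singleton.1 hd₀
  rw [← hz] at hx
  obtain ⟨d, rfl⟩ := (Submodule.mem_span_range_iff_exists_fun R).1 hx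
  have hone : d₀ * t + ∑ i, d i * vr i = 1 := Subtype.coe_injective <| by
    push_cast
    rw [← hgt, ← hgx, add_mul, Finset.sum_mul]
    refine congrArg₂ _ (by simp [Subring.smul_def]) (Finset.sum_congr rfl fun i _ => ?_)
    rw [hvr', Subring.smul_def, smul_eq_mul]; noncomm_ring
  have hItop : I ≠ ⊤ := fun hI => M.ne_top_of_isSimpleRing_quotient (top_le_iff.1 (hI ▸ hIM))
  obtain ⟨x, hxI, hxd⟩ := Ideal.exists_forall_mul_mem_of_essential (E := Ideal.span {s} ⊔ I)
    hItop le_sup_right hess Finset.univ d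
  refine hxI ?_
  rw [← mul_one x, ← hone, mul_add, ← mul_assoc, Finset.mul_sum]
  refine I.add_mem (I.mul_mem_left _ htI) (I.sum_mem fun i _ => ?_)
  obtain ⟨ρ, j, hj, e⟩ := Ideal.mem_span_singleton_sup.1 (hxd i (Finset.mem_univ i))
  rw [← mul_assoc, ← e, add_mul, mul_assoc]
  exact I.add_mem (I.mul_mem_left _ (hsv i)) (Ideal.IsTwoSided.mul_mem_of_left _ hj)

end Essential

/-! ### A criterion for Goldie rings -/

section Goldie

/-- Regular s become units of C: if cs = 0 and c = t⁻¹r, then rs = 0, so r = 0 and c = 0.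
Conversely, elements that are units in C are regular, so the Ore condition holds and the
localization is C. -/
theorem IsLeftGoldieRing.of_injective {B C : Type*} [Ring B] [Ring C] [IsSemisimpleRing C]
    (f : B →+* C) (hf : Function.Injective f)
    (hfrac : ∀ c : C, ∃ s r : B, IsUnit (f s) ∧ f s * c = f r) : IsLeftGoldieRing B := by
  have hunit : ∀ s ∈ B⁰, IsUnit (f s) := fun s hs =>
    IsArtinianRing.isUnit_of_forall_mul_eq_zero fun c hc => by
      obtain ⟨t, r, ht, e⟩ := hfrac c
      have h1 : r * s = 0 := hf (by rw [map_mul, ← e, mul_assoc, hc, mul_zero, map_zero])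
      rw [hs.2 r h1, map_zero] at e
      exact ht.mul_right_eq_zero.1 e
  have hreg : ∀ s, IsUnit (f s) → s ∈ B⁰ := fun s hs => by
    refine ⟨fun x hx => hf ?_, fun x hx => hf ?_⟩
    · have := congrArg f hx
      rw [map_mul, map_zero] at this
      rw [map_zero, hs.mul_right_eq_zero.1 this]
    · have := congrArg f hx
      rw [map_mul, map_zero] at this
      rw [map_zero, hs.mul_left_eq_zero.1 this]
  have hcancel : ∀ (r₁ r₂ : B) (s : B⁰), r₁ * s = r₂ * s → r₁ = r₂ := fun r₁ r₂ s h =>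
    sub_eq_zero.1 (s.2.2 _ (by rw [sub_mul, h, sub_self]))
  obtain ⟨hOre⟩ : Nonempty (OreLocalization.OreSet B⁰) := OreLocalization.nonempty_oreSet_iff.2
    ⟨fun r₁ r₂ s h => ⟨1, by rw [hcancel r₁ r₂ s h]⟩, fun r s => by
      obtain ⟨u, hu⟩ := hunit s s.2
      obtain ⟨t, r', ht, e⟩ := hfrac (f r * (u⁻¹ : Cˣ))
      refine ⟨r', ⟨t, hreg t ht⟩, hf ?_⟩
      rw [map_mul, map_mul, ← e, ← hu, mul_assoc, mul_assoc, Units.inv_mul, mul_one]⟩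
  refine ⟨hOre, ?_⟩
  let fS : B⁰ →* Cˣ := IsUnit.liftRight ((f : B →* C).comp B⁰.subtype) fun s => hunit s s.2
  have hfS : ∀ s : B⁰, f s = fS s := fun s => rfl
  let φ : OreLocalization B⁰ B →+* C := OreLocalization.universalHom f fS hfS
  have hφ : Function.Bijective φ := by
    constructor
    · rw [injective_iff_map_eq_zero]
      intro x
      induction x using OreLocalization.ind with | _ r s
      intro hx
      rw [show φ (r /ₒ s) = ((fS s)⁻¹ : Cˣ) * f r from rfl, Units.mul_right_eq_zero] at hx
      rw [hf (hx.trans (map_zero f).symm), OreLocalization.zero_oreDiv]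
    · intro c
      obtain ⟨s, r, hs, e⟩ := hfrac c
      refine ⟨r /ₒ ⟨s, hreg s hs⟩, ?_⟩
      rw [show φ (r /ₒ ⟨s, hreg s hs⟩) = ((fS ⟨s, hreg s hs⟩)⁻¹ : Cˣ) * f r from rfl, ← e,
        show f s = fS ⟨s, hreg s hs⟩ from rfl, ← mul_assoc, Units.inv_mul, one_mul]
  exact (RingEquiv.ofBijective φ hφ).symm.isSemisimpleRing

theorem IsGoldieRing.of_injective {B C : Type*} [Ring B] [Ring C] [IsSemisimpleRing C]
    (f : B →+* C) (hf : Function.Injective f)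
    (hl : ∀ c : C, ∃ s r : B, IsUnit (f s) ∧ f s * c = f r)
    (hr : ∀ c : C, ∃ s r : B, IsUnit (f s) ∧ c * f s = f r) : IsGoldieRing B := by
  refine ⟨.of_injective f hf hl, .of_injective (RingHom.op f)
    (fun x y hxy => MulOpposite.unop_injective (hf (MulOpposite.op_injective hxy))) fun c => ?_⟩
  obtain ⟨s, r, hs, e⟩ := hr c.unop
  exact ⟨.op s, .op r, hs.op, MulOpposite.unop_injective e⟩

end Goldie

section Essential

/-- A module without proper essential submodules is semisimple. -/
theorem IsSemisimpleModule.of_forall_essential_eq_top {S X : Type*} [Ring S] [AddCommGroup X]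
    [Module S X] (h : ∀ E : Submodule S X, (∀ N, Disjoint E N → N = ⊥) → E = ⊤) :
    IsSemisimpleModule S X := by
  refine { exists_isCompl := fun L => ?_ }
  -- For D maximal among submodules meeting L trivially, L ⊔ D is essential.
  obtain ⟨D, -, hD, hmax⟩ := zorn_le_nonempty₀ {D : Submodule S X | Disjoint L D}
    (fun c hc hchain y hy => ⟨sSup c, (hchain.directedOn.disjoint_sSup_right).2 fun D hD => hc hD,
      fun z hz => le_sSup hz⟩) ⊥ disjoint_bot_right
  refine ⟨D, hD, codisjoint_iff.2 (h _ fun N hN => ?_)⟩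
  have h1 : Disjoint L (D ⊔ N) := hD.disjoint_sup_right_of_disjoint_sup_left hN
  have h2 : N ≤ D := le_sup_right.trans (hmax h1 le_sup_left)
  exact le_bot_iff.1 (hN (h2.trans le_sup_right) le_rfl)

end Essential

/-! ### Top lengths of independent sums -/

section TopLength

variable {R X : Type*} [Ring R] [AddCommGroup X] [Module R X]

/-- The length of `N / I N`. -/
noncomputable def Submodule.topLength (N : Submodule R X) (I : Ideal R) : ℕ∞ :=
  Module.length R (N ⧸ (I • ⊤ : Submodule R N))

/-- The sum is direct, so its top maps onto the product of the two tops; the second is nonzero by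
Nakayama. -/
theorem Submodule.topLength_lt_sup {I : Ideal R} (hI : I ≤ Ring.jacobson R) {N₁ N₂ : Submodule R X}
    (hdisj : Disjoint N₁ N₂) (hfg : N₂.FG) (hne : N₂ ≠ ⊥) (hfin : N₁.topLength I ≠ ⊤) :
    N₁.topLength I < (N₁ ⊔ N₂).topLength I := by
  have hnt : Nontrivial (N₂ ⧸ (I • ⊤ : Submodule R N₂)) := by
    rw [Submodule.Quotient.nontrivial_iff]
    intro htop
    have hfin : Module.Finite R N₂ := Module.Finite.iff_fg.2 hfg
    have h1 : (⊤ : Submodule R N₂) = ⊥ := hfin.fg_top.eq_bot_of_le_jacobson_smul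
      (htop.ge.trans (Submodule.smul_mono_left hI))
    refine hne ((Submodule.eq_bot_iff _).2 fun x hx => ?_)
    have : (⟨x, hx⟩ : N₂) ∈ (⊥ : Submodule R N₂) := h1 ▸ Submodule.mem_top
    exact congrArg Subtype.val this
  let e : (N₁ × N₂) ≃ₗ[R] (N₁ ⊔ N₂ : Submodule R X) := LinearEquiv.ofBijective
    ((Submodule.inclusion le_sup_left).coprod (Submodule.inclusion le_sup_right)) (by
      constructor
      · rw [injective_iff_map_eq_zero]
        rintro ⟨⟨a, ha⟩, ⟨b, hb⟩⟩ hab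
        have hab' : a + b = 0 := congrArg Subtype.val hab
        have hb0 : b = 0 := by
          rw [Submodule.disjoint_def] at hdisj
          exact hdisj b (by rw [← neg_eq_of_add_eq_zero_right hab']; exact N₁.neg_mem ha) hb
        rw [hb0, add_zero] at hab'
        subst hb0 hab'
        rfl
      · rintro ⟨x, hx⟩
        obtain ⟨a, ha, b, hb, rfl⟩ := Submodule.mem_sup.1 hx
        exact ⟨(⟨a, ha⟩, ⟨b, hb⟩), rfl⟩)
  let φ : (N₁ ⊔ N₂ : Submodule R X) →ₗ[R]
      (N₁ ⧸ (I • ⊤ : Submodule R N₁)) × (N₂ ⧸ (I • ⊤ : Submodule R N₂)) :=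
    ((Submodule.mkQ _).prodMap (Submodule.mkQ _)).comp e.symm.toLinearMap
  have hφ : Function.Surjective φ :=
    (Function.Surjective.prodMap (Submodule.mkQ_surjective _)
      (Submodule.mkQ_surjective _)).comp e.symm.surjective
  have hker : (I • ⊤ : Submodule R (N₁ ⊔ N₂ : Submodule R X)) ≤ LinearMap.ker φ := by
    rw [Submodule.smul_le]
    intro r hr x _
    rw [LinearMap.mem_ker, map_smul]
    obtain ⟨a, ha⟩ := Submodule.mkQ_surjective _ (φ x).1
    obtain ⟨b, hb⟩ := Submodule.mkQ_surjective _ (φ x).2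
    rw [← Prod.mk.eta (p := φ x), ← ha, ← hb, Prod.smul_mk, ← map_smul, ← map_smul,
      Prod.mk_eq_zero]
    exact ⟨(Submodule.Quotient.mk_eq_zero _).2 (Submodule.smul_mem_smul hr Submodule.mem_top),
      (Submodule.Quotient.mk_eq_zero _).2 (Submodule.smul_mem_smul hr Submodule.mem_top)⟩
  have h1 := Module.length_le_of_surjective (Submodule.liftQ _ φ hker) fun y => by
    obtain ⟨x, rfl⟩ := hφ y
    exact ⟨Submodule.Quotient.mk x, rfl⟩
  rw [Module.length_prod] at h1
  refine lt_of_lt_of_le ?_ h1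
  have h2 := (ENat.add_lt_add_iff_left hfin).2 (Module.length_pos (R := R)
    (M := N₂ ⧸ (I • ⊤ : Submodule R N₂)))
  rwa [add_zero] at h2

theorem Submodule.topLength_span_singleton_le (I : Ideal R) (x : X) :
    (Submodule.span R {x}).topLength I ≤ Module.length R (R ⧸ I) := by
  refine Module.length_le_length_quotient_of_span_singleton
    (x := Submodule.Quotient.mk ⟨x, Submodule.mem_span_singleton_self x⟩) (fun r hr => ?_)
    (eq_top_iff.2 ?_)
  · rw [← Submodule.Quotient.mk_smul, Submodule.Quotient.mk_eq_zero]
    exact Submodule.smul_mem_smul hr Submodule.mem_top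
  · rintro y -
    obtain ⟨⟨y, hy⟩, rfl⟩ := Submodule.Quotient.mk_surjective _ y
    obtain ⟨r, rfl⟩ := Submodule.mem_span_singleton.1 hy
    exact Submodule.mem_span_singleton.2 ⟨r, rfl⟩

end TopLength

/-! ### Inverting p -/

section Localization

variable {A : Type*} [Ring A] {R : Subring A} {M : Ideal R} {p : R}

namespace IsNormalGenerator

theorem exists_pow_mul_eq_coe (hp : IsNormalGenerator M p) (n : ℕ) (r : R) :
    ∃ r' : R, (p : A) ^ n * r = r' * p ^ n := by
  obtain ⟨r', hr'⟩ := hp.exists_pow_mul_eq n r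
  exact ⟨r', by simpa using congrArg Subtype.val hr'⟩

/-- The ring of fractions of `R` with respect to the powers of the normal generator `p`. -/
def localization (hp : IsNormalGenerator M p) : Subring A where
  carrier := {q | ∃ n : ℕ, ∃ r : R, (p : A) ^ n * q = r}
  mul_mem' := by
    rintro q q' ⟨n, r, h⟩ ⟨m, r', h'⟩
    obtain ⟨r'', hr''⟩ := hp.exists_pow_mul_eq_coe m r
    refine ⟨m + n, r'' * r', ?_⟩
    rw [pow_add, mul_assoc, ← mul_assoc _ q, h, ← mul_assoc, hr'', mul_assoc, h']
    rfl
  one_mem' := ⟨0, 1, by simp⟩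
  add_mem' := by
    rintro q q' ⟨n, r, h⟩ ⟨m, r', h'⟩
    refine ⟨m + n, p ^ m * r + p ^ n * r', ?_⟩
    push_cast
    rw [mul_add, ← h, ← h', ← mul_assoc, ← mul_assoc, ← pow_add, ← pow_add, add_comm n m]
  zero_mem' := ⟨0, 0, by simp⟩
  neg_mem' := by
    rintro q ⟨n, r, h⟩
    exact ⟨n, -r, by rw [mul_neg, h]; rfl⟩

theorem le_localization (hp : IsNormalGenerator M p) : R ≤ hp.localization :=
  fun q hq => ⟨0, ⟨q, hq⟩, by simp⟩

theorem exists_mul_pow_eq_of_mem_localization (hp : IsNormalGenerator M p)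
    (q : hp.localization) : ∃ n : ℕ, ∃ r : R, (q : A) * p ^ n = r := by
  obtain ⟨n, r, h⟩ := q.2
  obtain ⟨r', hr'⟩ := hp.exists_mul_pow_eq n r
  refine ⟨n, r', (hp.isUnit.pow n).mul_left_cancel ?_⟩
  rw [← mul_assoc, h]
  simpa using congrArg Subtype.val hr'

theorem exists_eq_pow_mul_of_mem_iInf [M.IsTwoSided] (hp : IsNormalGenerator M p) (n : ℕ) {x : R}
    (hx : x ∈ ⨅ n : ℕ, M ^ n) : ∃ y ∈ ⨅ n : ℕ, M ^ n, x = p ^ n * y := by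
  obtain ⟨y, rfl⟩ := (hp.mem_pow' n).1 (Ideal.mem_iInf.1 hx n)
  exact ⟨y, hp.mem_iInf_of_pow_mul_mem n hx, rfl⟩

theorem exists_eq_mul_pow_of_mem_iInf [M.IsTwoSided] (hp : IsNormalGenerator M p) (n : ℕ) {x : R}
    (hx : x ∈ ⨅ n : ℕ, M ^ n) : ∃ y ∈ ⨅ n : ℕ, M ^ n, x = y * p ^ n := by
  obtain ⟨y, rfl⟩ := (hp.mem_pow n).1 (Ideal.mem_iInf.1 hx n)
  exact ⟨y, hp.mem_iInf_of_mul_pow_mem n hx, rfl⟩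

/-- Division by p^n does not leave I, so I is already an ideal of the localization. -/
theorem exists_mem_iInf_coe_eq_of_pow_mul_eq [M.IsTwoSided] (hp : IsNormalGenerator M p) (n : ℕ)
    {q : A} {x : R} (hx : x ∈ ⨅ n : ℕ, M ^ n) (h : (p : A) ^ n * q = x) :
    ∃ y ∈ ⨅ n : ℕ, M ^ n, (y : A) = q := by
  obtain ⟨y, hy, rfl⟩ := hp.exists_eq_pow_mul_of_mem_iInf n hx
  exact ⟨y, hy, ((hp.isUnit.pow n).mul_left_cancel (by simpa using h)).symm⟩

/-- The intersection of the powers of `M`, as an ideal of the localization. -/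
def localizationIdeal [M.IsTwoSided] (hp : IsNormalGenerator M p) : Ideal hp.localization where
  carrier := {x | ∃ y ∈ ⨅ n : ℕ, M ^ n, (y : A) = x}
  add_mem' := by
    rintro _ _ ⟨y, hy, h⟩ ⟨y', hy', h'⟩
    exact ⟨y + y', add_mem hy hy', by simp [h, h']⟩
  zero_mem' := ⟨0, zero_mem _, rfl⟩
  smul_mem' := by
    rintro ⟨q, n, r, hq⟩ ⟨x, hx⟩ ⟨y, hy, rfl⟩
    refine hp.exists_mem_iInf_coe_eq_of_pow_mul_eq n (Ideal.mul_mem_left _ r hy) ?_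
    change _ * (q * (y : A)) = _
    rw [← mul_assoc, hq]
    rfl

instance [M.IsTwoSided] (hp : IsNormalGenerator M p) : hp.localizationIdeal.IsTwoSided where
  mul_mem_of_left := by
    rintro ⟨_, hx⟩ ⟨q, n, r, hq⟩ ⟨y, hy, rfl⟩
    obtain ⟨z, hz, rfl⟩ := hp.exists_eq_mul_pow_of_mem_iInf n hy
    refine ⟨z * r, (Ideal.isTwoSided_iInf_pow M).mul_mem_of_left r hz, ?_⟩
    push_cast
    rw [mul_assoc, hq]

theorem mem_localizationIdeal [M.IsTwoSided] (hp : IsNormalGenerator M p) {x : hp.localization} :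
    x ∈ hp.localizationIdeal ↔ ∃ y ∈ ⨅ n : ℕ, M ^ n, (y : A) = x := Iff.rfl

end IsNormalGenerator

end Localization

namespace IsNormalGenerator

variable {A : Type*} [Ring A] {R : Subring A} {M : Ideal R} [M.IsTwoSided] {p : R}

/-- The map from `R` to the quotient of its localization at the powers of `p`. -/
def toQuotient (hp : IsNormalGenerator M p) : R →+* hp.localization ⧸ hp.localizationIdeal :=
  (Ideal.Quotient.mk _).comp (Subring.inclusion hp.le_localization)

theorem toQuotient_eq_zero_iff (hp : IsNormalGenerator M p) {x : R} :
    hp.toQuotient x = 0 ↔ x ∈ ⨅ n : ℕ, M ^ n := by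
  rw [toQuotient, RingHom.comp_apply, Ideal.Quotient.eq_zero_iff_mem, mem_localizationIdeal]
  constructor
  · rintro ⟨y, hy, hyx⟩
    rwa [← Subtype.coe_injective (a₁ := y) (a₂ := x) hyx]
  · exact fun hx => ⟨x, hx, rfl⟩

theorem isUnit_toQuotient_pow (hp : IsNormalGenerator M p) (n : ℕ) :
    IsUnit (hp.toQuotient (p ^ n)) := by
  obtain ⟨⟨a, b, hab, hba⟩, ha : a = ((p ^ n : R) : A)⟩ := hp.isUnit_pow n
  subst ha
  have hb : b ∈ hp.localization := ⟨n, 1, by simpa using hab⟩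
  let u : hp.localization := Subring.inclusion hp.le_localization (p ^ n)
  refine IsUnit.map (Ideal.Quotient.mk hp.localizationIdeal) (x := u)
    ⟨⟨u, ⟨b, hb⟩, Subtype.coe_injective hab, Subtype.coe_injective hba⟩, rfl⟩

theorem exists_pow_mul_eq_toQuotient (hp : IsNormalGenerator M p)
    (c : hp.localization ⧸ hp.localizationIdeal) :
    ∃ n r, hp.toQuotient (p ^ n) * c = hp.toQuotient r := by
  obtain ⟨⟨q, n, r, hq⟩, rfl⟩ := Ideal.Quotient.mk_surjective c
  refine ⟨n, r, ?_⟩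
  rw [toQuotient, RingHom.comp_apply, RingHom.comp_apply, ← map_mul]
  exact congrArg _ (Subtype.coe_injective (by simpa using hq))

theorem exists_mul_pow_eq_toQuotient (hp : IsNormalGenerator M p)
    (c : hp.localization ⧸ hp.localizationIdeal) :
    ∃ n r, c * hp.toQuotient (p ^ n) = hp.toQuotient r := by
  obtain ⟨q, rfl⟩ := Ideal.Quotient.mk_surjective c
  obtain ⟨n, r, hq⟩ := hp.exists_mul_pow_eq_of_mem_localization q
  refine ⟨n, r, ?_⟩
  rw [toQuotient, RingHom.comp_apply, RingHom.comp_apply, ← map_mul]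
  exact congrArg _ (Subtype.coe_injective (by simpa using hq))

end IsNormalGenerator

/-! ### Goldie primes of R -/

section SemisimpleLocalization

variable {A : Type*} [Ring A] [IsSimpleRing A] [IsArtinianRing A]
variable {R : Subring A} {M : Ideal R} [M.IsTwoSided]
variable [IsSimpleRing (R ⧸ M)] [IsArtinianRing (R ⧸ M)]

/-- An essential left ideal contains, modulo `I`, a finitely generated essential left ideal. -/
theorem IsDubrovinPair.exists_fg_essential (h : IsDubrovinPair R M) {I E : Ideal R}
    (hE : ∀ x ∉ I, ∃ r, r * x ∉ I ∧ r * x ∈ E) :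
    ∃ N : Ideal R, N.FG ∧ N ≤ E ∧ ∀ x ∉ I, ∃ r, r * x ∉ I ∧ r * x ∈ N ⊔ I := by
  have hbound : ∀ N : Ideal R, N.FG ∧ N ≤ E →
      (Submodule.map I.mkQ N).topLength M ≤ Module.length R (R ⧸ M) := by
    rintro N ⟨hN, -⟩
    obtain ⟨z, rfl⟩ := h.exists_ideal_eq_span_singleton hN
    rw [Ideal.span, Submodule.map_span, Set.image_singleton]
    exact Submodule.topLength_span_singleton_le _ _
  -- Images of finitely generated N in R/I are cyclic, so their top lengths are bounded. If an N
  -- with longest top were not essential over I, an independent cyclic piece of E would lengthen it.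
  obtain ⟨N, ⟨hN, hNE⟩, hmax⟩ := ENat.exists_max_of_forall_le
    (p := fun N : Ideal R => N.FG ∧ N ≤ E) (f := fun N => (Submodule.map I.mkQ N).topLength M)
    (Ideal.length_quotient_ne_top M) ⟨⊥, Submodule.fg_bot, bot_le⟩ hbound
  refine ⟨N, hN, hNE, fun x hx => ?_⟩
  obtain ⟨r, hrx, hrE⟩ := hE x hx
  by_contra! hcon
  have hdisj : Disjoint (Submodule.map I.mkQ N) (Submodule.map I.mkQ (Ideal.span {r * x})) := by
    rw [Submodule.disjoint_def]
    rintro y ⟨n, hn, rfl⟩ ⟨m, hm, hmn⟩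
    obtain ⟨c, rfl⟩ := Ideal.mem_span_singleton'.1 hm
    rw [← hmn]
    refine (Submodule.Quotient.mk_eq_zero _).2 ?_
    by_contra hc
    refine hcon (c * r) (by rwa [mul_assoc]) ?_
    rw [mul_assoc, ← add_sub_cancel n (c * (r * x))]
    exact Submodule.add_mem_sup hn ((Submodule.Quotient.eq _).1 hmn)
  have hne : Submodule.map I.mkQ (Ideal.span {r * x}) ≠ ⊥ := fun h0 => hrx <| by
    rw [← LinearMap.le_ker_iff_map, Submodule.ker_mkQ] at h0
    exact h0 (Ideal.mem_span_singleton_self _)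
  have hlt := Submodule.topLength_lt_sup h.eq_jacobson.le hdisj
    (Submodule.FG.map _ (Submodule.fg_span_singleton _)) hne
    (ne_top_of_le_ne_top (Ideal.length_quotient_ne_top M) (hbound N ⟨hN, hNE⟩))
  rw [← Submodule.map_sup] at hlt
  exact absurd (hmax (N ⊔ Ideal.span {r * x}) ⟨Submodule.FG.sup hN (Submodule.fg_span_singleton _),
    sup_le hNE (Ideal.span_le.2 (by simpa using hrE))⟩) (not_le.2 hlt)

/-- A unit g of A taken from I ≠ 0 is added to a finitely generated essential N, so that the
generator of N + Rg is a unit of A. -/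
theorem IsDubrovinPair.exists_pow_mem_of_essential {p : R} (h : IsDubrovinPair R M)
    (hp : IsNormalGenerator M p) (hI : (⨅ n : ℕ, M ^ n) ≠ ⊥) {E : Ideal R}
    (hIE : (⨅ n : ℕ, M ^ n) ≤ E)
    (hE : ∀ x ∉ ⨅ n : ℕ, M ^ n, ∃ r, r * x ∉ (⨅ n : ℕ, M ^ n) ∧ r * x ∈ E) :
    ∃ n, p ^ n ∈ E := by
  obtain ⟨N, hN, hNE, hess⟩ := h.exists_fg_essential hE
  have := Ideal.isTwoSided_iInf_pow M
  obtain ⟨g, hg, hgu⟩ := h.exists_isUnit_mem hI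
  obtain ⟨s, hs⟩ := h.exists_ideal_eq_span_singleton
    (Submodule.FG.sup hN (Submodule.fg_span_singleton g))
  have hle : Ideal.span {s} ≤ E := hs ▸ sup_le hNE
    (Ideal.span_le.2 (by simpa using hIE hg))
  obtain ⟨r, hr⟩ := Ideal.mem_span_singleton'.1
    (hs ▸ Submodule.mem_sup_right (Ideal.mem_span_singleton_self g) : g ∈ Ideal.span {s})
  have hsu : IsUnit (s : A) := isUnit_of_mul_isUnit_right (x := (r : A)) (by
    rw [← hr] at hgu; simpa using hgu)
  obtain ⟨n, hn⟩ := h.exists_pow_mem_span_of_essential hp hsu fun x hx => by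
    obtain ⟨r, hr, hrN⟩ := hess x hx
    have hle' : N ⊔ (⨅ n : ℕ, M ^ n) ≤ Ideal.span {s} ⊔ ⨅ n : ℕ, M ^ n :=
      sup_le_sup_right (hs ▸ le_sup_left) _
    exact ⟨r, hr, hle' hrN⟩
  exact ⟨n, hle hn⟩

namespace IsNormalGenerator

variable {p : R}

/-- An essential left ideal of the quotient pulls back to a left ideal of R essential over I. This
contains some p^n, which becomes a unit, so no proper left ideal is essential. -/
theorem isSemisimpleRing_quotient (hp : IsNormalGenerator M p) (h : IsDubrovinPair R M)
    (hI : (⨅ n : ℕ, M ^ n) ≠ ⊥) :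
    IsSemisimpleRing (hp.localization ⧸ hp.localizationIdeal) := by
  refine IsSemisimpleModule.of_forall_essential_eq_top fun E hE => ?_
  let E' : Ideal R := Ideal.comap hp.toQuotient E
  have hmem : ∀ {x}, x ∈ E' ↔ hp.toQuotient x ∈ E := Iff.rfl
  obtain ⟨n, hn⟩ := h.exists_pow_mem_of_essential hp hI (E := E')
    (fun x hx => by rw [hmem, hp.toQuotient_eq_zero_iff.2 hx]; exact E.zero_mem) fun x hx => by
      have h1 : ¬ Disjoint E (Ideal.span {hp.toQuotient x}) := fun hd => hx <| by
        have h2 := hE _ hd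
        rw [← hp.toQuotient_eq_zero_iff]
        exact Ideal.span_singleton_eq_bot.1 h2
      rw [Submodule.disjoint_def] at h1
      push Not at h1
      obtain ⟨y, hyE, hy, hy0⟩ := h1
      obtain ⟨c, rfl⟩ := Ideal.mem_span_singleton'.1 hy
      obtain ⟨n, r, hr⟩ := hp.exists_pow_mul_eq_toQuotient c
      refine ⟨r, fun h0 => hy0 ?_, ?_⟩
      · rw [← hp.toQuotient_eq_zero_iff, map_mul, ← hr, mul_assoc] at h0
        exact (hp.isUnit_toQuotient_pow n).mul_right_eq_zero.1 h0
      · rw [hmem, map_mul, ← hr, mul_assoc]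
        exact E.smul_mem _ hyE
  exact Ideal.eq_top_of_isUnit_mem E hn (hp.isUnit_toQuotient_pow n)

theorem isGoldiePrime_iInf (hp : IsNormalGenerator M p) (h : IsDubrovinPair R M)
    (hI : (⨅ n : ℕ, M ^ n) ≠ ⊥) : IsGoldiePrime (⨅ n : ℕ, M ^ n) := by
  have htwo := Ideal.isTwoSided_iInf_pow M
  have hle : (⨅ n : ℕ, M ^ n) ≤ M := (iInf_le _ 1).trans (Submodule.pow_one M).le
  have := hp.isSemisimpleRing_quotient h hI
  refine ⟨htwo, fun htop => M.ne_top_of_isSimpleRing_quotient (top_le_iff.1 (htop ▸ hle)),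
    fun a b => hp.mem_or_mem_of_forall_mul_mem, ?_⟩
  let f : (R ⧸ ⨅ n : ℕ, M ^ n) →+* hp.localization ⧸ hp.localizationIdeal :=
    Ideal.Quotient.lift _ hp.toQuotient fun x hx => hp.toQuotient_eq_zero_iff.2 hx
  refine IsGoldieRing.of_injective f (RingHom.lift_injective_of_ker_le_ideal _ _ fun x hx =>
    hp.toQuotient_eq_zero_iff.1 hx) (fun c => ?_) fun c => ?_
  · obtain ⟨n, r, hr⟩ := hp.exists_pow_mul_eq_toQuotient c
    exact ⟨Ideal.Quotient.mk _ (p ^ n), Ideal.Quotient.mk _ r, hp.isUnit_toQuotient_pow n, hr⟩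
  · obtain ⟨n, r, hr⟩ := hp.exists_mul_pow_eq_toQuotient c
    exact ⟨Ideal.Quotient.mk _ (p ^ n), Ideal.Quotient.mk _ r, hp.isUnit_toQuotient_pow n, hr⟩

end IsNormalGenerator

/-- If aRb = 0 with b ≠ 0, then a kills RbR, which contains a unit of A. The ring of fractions is A.
-/
theorem IsDubrovinPair.isGoldiePrime_bot (h : IsDubrovinPair R M) :
    IsGoldiePrime (⊥ : Ideal R) := by
  have hss : IsSemisimpleRing A := IsSimpleRing.isSemisimpleRing_iff_isArtinianRing.2 inferInstance
  have hnt : Nontrivial R := ⟨⟨0, 1, fun h01 => zero_ne_one (α := A) (congrArg Subtype.val h01)⟩⟩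
  refine ⟨inferInstance, bot_ne_top, fun a b hab => ?_, ?_⟩
  · by_contra! hcon
    let Q : Ideal R := Ideal.span (Set.range fun r => b * r)
    have hQ : Q.IsTwoSided := ⟨fun {x} c hx => by
      induction hx using Submodule.span_induction with
      | mem x hx =>
        obtain ⟨r, rfl⟩ := hx
        exact Ideal.subset_span ⟨r * c, by simp [mul_assoc]⟩
      | zero => rw [zero_mul]; exact Q.zero_mem
      | add x z _ _ hx hz => rw [add_mul]; exact Q.add_mem hx hz
      | smul d x _ hx => rw [smul_eq_mul, mul_assoc]; exact Q.mul_mem_left d hx⟩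
    have haQ : ∀ x ∈ Q, ∀ r, a * r * x = 0 := fun x hx => by
      induction hx using Submodule.span_induction with
      | mem x hx =>
        obtain ⟨r', rfl⟩ := hx
        intro r
        rw [← mul_assoc, (Ideal.mem_bot).1 (hab r), zero_mul]
      | zero => simp
      | add x z _ _ hx hz => intro r; rw [mul_add, hx, hz, add_zero]
      | smul d x _ hx => intro r; rw [smul_eq_mul, ← mul_assoc, mul_assoc a, hx]
    obtain ⟨u, hu, hunit⟩ := h.exists_isUnit_mem (I := Q) fun h0 => hcon.2 <| by
      rw [← h0]
      exact Ideal.subset_span ⟨1, by simp⟩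
    have := haQ u hu 1
    rw [mul_one] at this
    exact hcon.1 (Subtype.coe_injective (hunit.mul_left_eq_zero.1
      (by simpa using congrArg Subtype.val this)))
  · let f : (R ⧸ (⊥ : Ideal R)) →+* A := Ideal.Quotient.lift _ R.subtype fun x hx => by
      rw [(Ideal.mem_bot).1 hx, map_zero]
    refine IsGoldieRing.of_injective f (RingHom.lift_injective_of_ker_le_ideal _ _
      fun x hx => Subtype.coe_injective hx) (fun c => ?_) fun c => ?_
    · obtain ⟨y, u, hu, e⟩ := h.exists_left_fraction c
      exact ⟨Ideal.Quotient.mk _ u, Ideal.Quotient.mk _ y, hu, e⟩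
    · obtain ⟨y, u, hu, e⟩ := h.exists_right_fraction c
      exact ⟨Ideal.Quotient.mk _ u, Ideal.Quotient.mk _ y, hu, e⟩

theorem Ideal.isGoldiePrime_of_isSimpleRing_quotient {R : Type*} [Ring R] (M : Ideal R)
    [M.IsTwoSided] [IsSimpleRing (R ⧸ M)] [IsArtinianRing (R ⧸ M)] : IsGoldiePrime M :=
  have : IsSemisimpleRing (R ⧸ M) := IsSimpleRing.isSemisimpleRing_iff_isArtinianRing.2 ‹_›
  ⟨inferInstance, M.ne_top_of_isSimpleRing_quotient,
    fun _ _ => Ideal.mem_or_mem_of_isSimpleRing_quotient,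
    IsGoldieRing.of_injective (RingHom.id _) Function.injective_id
      (fun c => ⟨1, c, by simp, by simp⟩) fun c => ⟨1, c, by simp, by simp⟩⟩

end SemisimpleLocalization

/-! ### Noetherianity when I = 0 -/

section Noetherian

variable {A : Type*} [Ring A] [IsSimpleRing A] [IsArtinianRing A]
variable {R : Subring A} {M : Ideal R} [M.IsTwoSided]
variable [IsSimpleRing (R ⧸ M)] [IsArtinianRing (R ⧸ M)]

/-- Ru is essential in R: writing xu⁻¹ = w⁻¹y gives wx = yu, nonzero when x is. -/
theorem IsDubrovinPair.exists_pow_mem_span_of_isUnit {p : R} (h : IsDubrovinPair R M)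
    (hp : IsNormalGenerator M p) (hI : (⨅ n : ℕ, M ^ n) = ⊥) {u : R} (hu : IsUnit (u : A)) :
    ∃ n, p ^ n ∈ Ideal.span {u} := by
  refine h.exists_pow_mem_span_of_essential hp hu ?_
  rw [hI]
  intro x hx
  obtain ⟨v, hv⟩ := hu
  obtain ⟨y, w, hw, e⟩ := h.exists_left_fraction (x * (v⁻¹ : Aˣ))
  refine ⟨w, fun h0 => hx ?_, Submodule.mem_sup_left (Ideal.mem_span_singleton'.2 ⟨y, ?_⟩)⟩
  · exact (Ideal.mem_bot).2 (Subtype.coe_injective (hw.mul_right_eq_zero.1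
      (by simpa using congrArg Subtype.val ((Ideal.mem_bot).1 h0))))
  · refine Subtype.coe_injective ?_
    push_cast
    rw [← e, ← hv, mul_assoc, mul_assoc, Units.inv_mul, mul_one]

/-- L/(L ∩ M) embeds in the Noetherian module R/M, and L ∩ M = (L : p)p, where (L : p) contains one
lower power of p. -/
theorem IsNormalGenerator.fg_of_pow_mem {A : Type*} [Ring A] {R : Subring A} {M : Ideal R}
    [M.IsTwoSided] [IsArtinianRing (R ⧸ M)] {p : R} (hp : IsNormalGenerator M p) (n : ℕ)
    (L : Ideal R) (hL : p ^ n ∈ L) : L.FG := by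
  have : IsNoetherian R (R ⧸ M) := (isFiniteLength_iff_isNoetherian_isArtinian.1
    (Module.length_ne_top_iff.1 (Ideal.length_quotient_ne_top M))).1
  induction n generalizing L with
  | zero =>
    rw [pow_zero, ← Ideal.eq_top_iff_one] at hL
    rw [hL]
    exact Ideal.fg_top R
  | succ n ih =>
    refine Submodule.fg_of_fg_map_of_fg_inf_ker M.mkQ (IsNoetherian.noetherian _) ?_
    have h1 := ih (Submodule.comap (LinearMap.toSpanSingleton R R p) L)
      (show p ^ n * p ∈ L by rwa [← pow_succ])
    suffices e : L ⊓ LinearMap.ker M.mkQ = Submodule.map (LinearMap.toSpanSingleton R R p)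
        (Submodule.comap (LinearMap.toSpanSingleton R R p) L) by
      rw [e]
      exact Submodule.FG.map _ h1
    ext x
    rw [Submodule.ker_mkQ, Submodule.mem_inf, hp.eq_span, Ideal.mem_span_singleton',
      Submodule.mem_map]
    constructor
    · rintro ⟨hx, r, rfl⟩
      exact ⟨r, hx, rfl⟩
    · rintro ⟨r, hr, rfl⟩
      exact ⟨hr, r, rfl⟩

/-- Take a complement V of AL in A and L' = V ∩ R. Then L ∩ L' = 0, and L + L' contains a unit of A,
hence a power of p. So L + L' is finitely generated, and so is its summand L. -/
theorem IsDubrovinPair.isNoetherianRing {p : R} (h : IsDubrovinPair R M)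
    (hp : IsNormalGenerator M p) (hI : (⨅ n : ℕ, M ^ n) = ⊥) : IsNoetherianRing R := by
  refine (isNoetherianRing_iff_ideal_fg R).2 fun L => ?_
  have : IsSemisimpleRing A := IsSimpleRing.isSemisimpleRing_iff_isArtinianRing.2 inferInstance
  obtain ⟨V, hV⟩ := exists_isCompl (h.leftFractions L)
  let L' : Ideal R := V.comap R.subtype
  have hdisj : L ⊓ L' = ⊥ := (Submodule.eq_bot_iff _).2 fun x hx => Subtype.coe_injective <|
    (Submodule.disjoint_def.1 hV.disjoint) x (h.coe_mem_leftFractions hx.1) hx.2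
  have htop : h.leftFractions (L ⊔ L') = ⊤ := by
    refine top_le_iff.1 (hV.sup_eq_top ▸ sup_le ?_ fun v hv => ?_)
    · rintro x ⟨u, hu, b, hb, e⟩
      exact ⟨u, hu, b, Submodule.mem_sup_left hb, e⟩
    · obtain ⟨y, u, hu, e⟩ := h.exists_left_fraction v
      refine ⟨u, hu, y, Submodule.mem_sup_right ?_, e⟩
      change (y : A) ∈ V
      rw [← e]
      exact V.mul_mem_left _ hv
  obtain ⟨u, hu, hunit⟩ := h.exists_isUnit_mem_of_leftFractions_eq_top htop
  obtain ⟨n, hn⟩ := h.exists_pow_mem_span_of_isUnit hp hI hunit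
  have hfg := hp.fg_of_pow_mem n (L ⊔ L')
    ((Ideal.span_le (I := L ⊔ L')).2 (by simpa using hu) hn)
  refine Submodule.fg_of_fg_map_of_fg_inf_ker (Submodule.mkQ L') ?_ ?_
  · have := Submodule.FG.map (Submodule.mkQ L') hfg
    rwa [Submodule.map_sup, Submodule.mkQ_map_self, sup_bot_eq] at this
  · rw [Submodule.ker_mkQ, hdisj]
    exact Submodule.fg_bot

end Noetherian

/-! ### Transfer to the opposite ring -/

section Opposite

variable {A : Type*} [Ring A] {R : Subring A} {M : Ideal R} [M.IsTwoSided]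

theorem IsNormalGenerator.op {p : R} (hp : IsNormalGenerator M p) :
    IsNormalGenerator (Subring.opIdeal M) (⟨.op p.1, p.2⟩ : R.op) := by
  refine ⟨hp.isUnit.op, ?_, fun r => ?_, fun r => ?_⟩
  · ext x
    rw [Subring.mem_opIdeal, Ideal.mem_span_singleton', ← Submodule.pow_one M, hp.mem_pow',
      pow_one]
    constructor
    · rintro ⟨r, hr⟩
      exact ⟨⟨.op r.1, r.2⟩, Subtype.coe_injective
        (congrArg (fun y : R => MulOpposite.op y.1) hr)⟩
    · rintro ⟨r, rfl⟩
      exact ⟨⟨r.1.unop, r.2⟩, rfl⟩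
  · obtain ⟨r', hr'⟩ := hp.exists_mul_eq' ⟨r.1.unop, r.2⟩
    exact ⟨⟨.op r'.1, r'.2⟩, Subtype.coe_injective
      (congrArg (fun y : R => MulOpposite.op y.1) hr')⟩
  · obtain ⟨r', hr'⟩ := hp.exists_mul_eq ⟨r.1.unop, r.2⟩
    exact ⟨⟨.op r'.1, r'.2⟩, Subtype.coe_injective
      (congrArg (fun y : R => MulOpposite.op y.1) hr')⟩

theorem Subring.opIdeal_mul_self_le {x : R.op} (hx : x ∈ opIdeal M * opIdeal M) :
    (⟨x.1.unop, x.2⟩ : R) ∈ M * M := by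
  refine Submodule.smul_induction_on (p := fun x : R.op => (⟨x.1.unop, x.2⟩ : R) ∈ M * M) hx
    (fun a ha b hb => ?_) fun a b ha hb => add_mem ha hb
  exact Ideal.mul_mem_mul (mem_opIdeal.1 hb) (mem_opIdeal.1 ha)

theorem Subring.opIdeal_iInf_pow_eq_bot (hM : (⨅ n : ℕ, M ^ n) = ⊥) {p : R}
    (hp : IsNormalGenerator M p) : (⨅ n : ℕ, opIdeal M ^ n) = ⊥ := by
  refine (Submodule.eq_bot_iff _).2 fun x hx => ?_
  have h1 : (⟨x.1.unop, x.2⟩ : R) ∈ ⨅ n : ℕ, M ^ n := by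
    rw [Ideal.mem_iInf] at hx ⊢
    intro n
    obtain ⟨r, hr⟩ := (hp.op.mem_pow n).1 (hx n)
    refine (hp.mem_pow' n).2 ⟨⟨r.1.unop, r.2⟩, Subtype.coe_injective ?_⟩
    have := congrArg (fun y : R.op => y.1.unop) hr
    simpa using this
  rw [hM, Ideal.mem_bot] at h1
  exact Subtype.coe_injective (MulOpposite.unop_injective (congrArg Subtype.val h1))

end Opposite

/-! ### Rank and the intersection of powers -/

section Rank

variable {A : Type*} [Ring A] [IsSimpleRing A] [IsArtinianRing A]
variable {R : Subring A} {M : Ideal R} [M.IsTwoSided]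
variable [IsSimpleRing (R ⧸ M)] [IsArtinianRing (R ⧸ M)]

/-- If p ∉ Q and zp ∈ Q, then zRp ⊆ zpR ⊆ Q, so z ∈ Q by primeness. As Q ⊆ Rp, this gives Q = Qp^n ⊆
M^n for all n. -/
theorem IsDubrovinPair.eq_bot_or_eq_of_isGoldiePrime {A : Type*} [Ring A] [IsSimpleRing A]
    [IsArtinianRing A] {R : Subring A} {M : Ideal R} [M.IsTwoSided] [IsSimpleRing (R ⧸ M)]
    {p : R} (h : IsDubrovinPair R M)
    (hp : IsNormalGenerator M p) (hI : (⨅ n : ℕ, M ^ n) = ⊥) {Q : Ideal R} (hQ : IsGoldiePrime Q) :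
    Q = ⊥ ∨ Q = M := by
  have := hQ.isTwoSided
  have hQM : Q ≤ M := h.le_of_ne_top hQ.ne_top
  by_cases hpQ : p ∈ Q
  · exact .inr (le_antisymm hQM (hp.eq_span ▸ Ideal.span_le.2 (by simpa using hpQ)))
  · have key : ∀ n : ℕ, ∀ x ∈ Q, ∃ y ∈ Q, y * p ^ n = x := fun n => by
      induction n with
      | zero => exact fun x hx => ⟨x, hx, by simp⟩
      | succ n ih =>
        intro x hx
        obtain ⟨y, hy, rfl⟩ := ih x hx
        obtain ⟨z, rfl⟩ := (hp.mem_pow 1).1 (by rw [Submodule.pow_one]; exact hQM hy : y ∈ M ^ 1)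
        refine ⟨z, (hQ.mem_or_mem z p fun r => ?_).resolve_right hpQ, by
          rw [pow_succ', pow_one, mul_assoc]⟩
        obtain ⟨r', hr'⟩ := hp.exists_mul_eq' r
        rw [mul_assoc, hr', ← mul_assoc, ← pow_one p]
        exact Ideal.IsTwoSided.mul_mem_of_left r' hy
    refine .inl (le_bot_iff.1 (hI ▸ le_iInf fun n x hx => ?_))
    obtain ⟨y, -, rfl⟩ := key n x hx
    exact (hp.mem_pow n).2 ⟨y, rfl⟩

theorem IsDubrovinPair.goldieRank_eq_one {p : R} (h : IsDubrovinPair R M)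
    (hp : IsNormalGenerator M p) (hI : (⨅ n : ℕ, M ^ n) = ⊥) (hM : M ≠ ⊥) : goldieRank R = 1 := by
  let B : {Q : Ideal R // IsGoldiePrime Q} := ⟨⊥, h.isGoldiePrime_bot⟩
  let T : {Q : Ideal R // IsGoldiePrime Q} := ⟨M, M.isGoldiePrime_of_isSimpleRing_quotient⟩
  have hlt : B < T := Subtype.mk_lt_mk.2 (bot_lt_iff_ne_bot.2 hM)
  refine le_antisymm (Order.krullDim_le_one_iff.2 fun Q => ?_)
    (Order.one_le_krullDim_iff.2 ⟨B, T, hlt⟩)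
  obtain hQ | hQ := h.eq_bot_or_eq_of_isGoldiePrime hp hI Q.2
  · exact .inl fun Q' _ => (hQ.le.trans bot_le : Q.1 ≤ Q'.1)
  · refine .inr fun Q' _ => ?_
    have := Q'.2.isTwoSided
    exact (h.le_of_ne_top Q'.2.ne_top).trans hQ.ge

/-- A nonzero I would be a Goldie prime, and I ⊆ M² ≠ M makes 0, I, M a chain of length 2. -/
theorem IsDubrovinPair.iInf_pow_eq_bot_of_goldieRank_eq_one {p : R} (h : IsDubrovinPair R M)
    (hp : IsNormalGenerator M p) (hM : M ≠ M * M) (hrank : goldieRank R = 1) :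
    (⨅ n : ℕ, M ^ n) = ⊥ := by
  by_contra hI
  have hlt : (⨅ n : ℕ, M ^ n) < M := by
    refine lt_of_le_of_ne ((iInf_le _ 1).trans (Submodule.pow_one M).le) fun heq => hM ?_
    refine le_antisymm ?_ Ideal.mul_le_left
    conv_lhs => rw [← heq]
    exact (iInf_le _ 2).trans (by rw [Ideal.IsTwoSided.pow_succ, Submodule.pow_one])
  let B : {Q : Ideal R // IsGoldiePrime Q} := ⟨⊥, h.isGoldiePrime_bot⟩
  let Q : {Q : Ideal R // IsGoldiePrime Q} := ⟨⨅ n : ℕ, M ^ n, hp.isGoldiePrime_iInf h hI⟩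
  let T : {Q : Ideal R // IsGoldiePrime Q} := ⟨M, M.isGoldiePrime_of_isSimpleRing_quotient⟩
  have hBQ : B < Q := Subtype.mk_lt_mk.2 (bot_lt_iff_ne_bot.2 hI)
  have hQT : Q < T := Subtype.mk_lt_mk.2 hlt
  obtain hQ | hQ := Order.krullDim_le_one_iff.1 (show Order.krullDim _ ≤ 1 from hrank.le) Q
  · exact hQ.not_lt hBQ
  · exact hQ.not_lt hQT

end Rank

theorem Subring.isNoetherianRing_op_iff {A : Type*} [Ring A] {R : Subring A} :
    IsNoetherianRing R.op ↔ IsNoetherianRing Rᵐᵒᵖ :=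
  ⟨fun _ => isNoetherianRing_of_ringEquiv _ R.mopRingEquivOp.symm,
    fun _ => isNoetherianRing_of_ringEquiv _ R.mopRingEquivOp⟩

theorem Subring.opIdeal_ne_mul_self {A : Type*} [Ring A] {R : Subring A} {M : Ideal R}
    [M.IsTwoSided] (hM : M ≠ M * M) : opIdeal M ≠ opIdeal M * opIdeal M := by
  refine fun heq => hM (le_antisymm (fun x hx => ?_) Ideal.mul_le_left)
  have h1 : (⟨.op x.1, x.2⟩ : R.op) ∈ opIdeal M := hx
  rw [heq] at h1
  exact opIdeal_mul_self_le h1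

/-! ### The equivalences -/

section Main

variable {A : Type*} [Ring A] [IsSimpleRing A] [IsArtinianRing A]
variable {R : Subring A} {M : Ideal R} [M.IsTwoSided]
variable [IsSimpleRing (R ⧸ M)] [IsArtinianRing (R ⧸ M)]

theorem IsDubrovinPair.exists_isNormalGenerator (h : IsDubrovinPair R M) (hbot : M ≠ ⊥)
    (hM : M ≠ M * M) : ∃ p, IsNormalGenerator M p := by
  obtain ⟨p, hp⟩ := h.exists_eq_span hM
  obtain ⟨p', hp'⟩ := h.op.exists_eq_span (Subring.opIdeal_ne_mul_self hM)
  exact ⟨p, h.isNormalGenerator hbot hp hp'⟩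

theorem IsDubrovinPair.ne_mul_self_of_isNoetherianRing [IsNoetherianRing R]
    (h : IsDubrovinPair R M) (hbot : M ≠ ⊥) : M ≠ M * M := fun heq =>
  hbot (Submodule.FG.eq_bot_of_le_jacobson_smul (IsNoetherian.noetherian M)
    (h.eq_jacobson ▸ heq.le))

theorem IsDubrovinPair.iInf_pow_eq_bot_of_isNoetherianRing [IsNoetherianRing R]
    (h : IsDubrovinPair R M) {p : R} (hp : IsNormalGenerator M p) : (⨅ n : ℕ, M ^ n) = ⊥ := by
  refine Submodule.FG.eq_bot_of_le_jacobson_smul (IsNoetherian.noetherian _) fun x hx => ?_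
  obtain ⟨y, hy, rfl⟩ := hp.exists_eq_pow_mul_of_mem_iInf 1 hx
  rw [pow_one, ← h.eq_jacobson]
  exact Submodule.smul_mem_smul hp.mem hy

theorem IsDubrovinPair.isTwoSidedNoetherianRing (h : IsDubrovinPair R M) {p : R}
    (hp : IsNormalGenerator M p) (hI : (⨅ n : ℕ, M ^ n) = ⊥) : IsTwoSidedNoetherianRing R :=
  ⟨h.isNoetherianRing hp hI, Subring.isNoetherianRing_op_iff.1
    (h.op.isNoetherianRing hp.op (Subring.opIdeal_iInf_pow_eq_bot hI hp))⟩

theorem Ideal.le_iInf_pow_of_eq_mul_self {B : Type*} [Ring B] {I : Ideal B} [I.IsTwoSided]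
    (hI : I = I * I) : I ≤ ⨅ n : ℕ, I ^ n :=
  le_iInf fun n => by
    induction n with
    | zero => simp [Submodule.pow_zero, Ideal.one_eq_top]
    | succ n ih =>
      rw [Ideal.IsTwoSided.pow_succ]
      exact hI.le.trans (Ideal.mul_mono_right ih)

end Main

/-- The infimum also runs over n = 0, where the power is the whole ring, so it is the intersection
over n ≥ 1. -/
theorem mainTheorem3 {A : Type*} [Ring A] [IsSimpleRing A] [IsArtinianRing A]
    (R : Subring A) (hR : IsDubrovinValuationRing R) (hne : R ≠ ⊤) :
    List.TFAE [
      IsTwoSidedNoetherianRing R,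
      goldieRank R = 1 ∧ Ring.jacobson R ≠ Ring.jacobson R ^ 2,
      goldieRank R = 1 ∧ (⨅ n : ℕ, Ring.jacobson R ^ n) = ⊥] := by
  obtain ⟨M, htwo, hs, ha, hq⟩ := hR
  have h : IsDubrovinPair R M := ⟨fun q hq' => (hq q hq').1, fun q hq' => (hq q hq').2⟩
  have hbot : M ≠ ⊥ := h.ne_bot hne
  have hsq : M ^ 2 = M * M := by rw [Ideal.IsTwoSided.pow_succ, Submodule.pow_one]
  rw [← h.eq_jacobson, hsq]
  tfae_have 1 → 3 := by
    rintro ⟨h1, -⟩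
    obtain ⟨p, hp⟩ := h.exists_isNormalGenerator hbot (h.ne_mul_self_of_isNoetherianRing hbot)
    have hI := h.iInf_pow_eq_bot_of_isNoetherianRing hp
    exact ⟨h.goldieRank_eq_one hp hI hbot, hI⟩
  tfae_have 3 → 2 := fun h3 =>
    ⟨h3.1, fun heq => hbot (le_bot_iff.1 ((Ideal.le_iInf_pow_of_eq_mul_self heq).trans h3.2.le))⟩
  tfae_have 2 → 1 := by
    rintro ⟨h1, h2⟩
    obtain ⟨p, hp⟩ := h.exists_isNormalGenerator hbot h2
    exact h.isTwoSidedNoetherianRing hp (h.iInf_pow_eq_bot_of_goldieRank_eq_one hp h2 h1)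
  tfae_finish
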